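/- Let $(A,\mathfrak m)$ be a Noetherian local ring, let $M$ be a finitely generated Cohen–Macaulay $A$-module of dimension two, and let $I$ be an ideal of definition for $M$, that is, $I\subseteq\mathfrak m$ and $\mathfrak m^nM\subseteq IM$ for some $n$. Write $\lambda$ for length. Let $h_I(M,z)\in\mathbb Z[z]$ be the polynomial with $$\sum_{n\ge0}\lambda(I^nM/I^{n+1}M)\,z^n=\frac{h_I(M,z)}{(1-z)^2}$$ (it exists and is unique), and let $e_2^I(M)=\frac{1}{2!}\,h_I''(M,1)$, with derivatives taken in $z$. For $n\ge0$ let $\widetilde{I^nM}=\bigcup_{k\ge0}(I^{n+k}M:_MI^k)$ be the Ratliff–Rush filtration of $M$ with respect to $I$, and let $\widetilde G_I(M)=\bigoplus_{n\ge0}\widetilde{I^nM}/\widetilde{I^{n+1}M}$ be its associated graded module, a graded module over $G_I(A)=\bigoplus_{n\ge0}I^n/I^{n+1}$. One says that $\widetilde G_I(M)$ has minimal multiplicity if - it is Cohen–Macaulay, that is, its depth in the maximal homogeneous ideal $\mathfrak m/I\oplus\bigoplus_{n\ge1}I^n/I^{n+1}$ of $G_I(A)$ equals its dimension, and - $\sum_{n\ge0}\lambda(\widetilde{I^nM}/\widetilde{I^{n+1}M})z^n=\widetilde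 h(z)/(1-z)^2$ for a polynomial $\widetilde h\in\mathbb Z[z]$ of degree at most one. **Theorem 7.1.** The following conditions are equivalent: 1. $e_2^I(M)=0$; 2. $\widetilde G_I(M)$ has minimal multiplicity. -/

import Mathlib

/-!
Hilbert coefficients, the Ratliff-Rush filtration, and minimal multiplicity of its associated
graded module.
-/

namespace RatliffRush

open IsLocalRing

universe u v

section CohenMacaulay

variable (R : Type u) [CommRing R] (J : Ideal R) (E : Type v) [AddCommGroup E] [Module R E]

/-- The depth (grade) of `E` in the ideal `J`: the supremum of the lengths of the `E`-regular
sequences contained in `J`. -/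
noncomputable def depth : ℕ∞ :=
  ⨆ rs ∈ {rs : List R | (∀ r ∈ rs, r ∈ J) ∧ RingTheory.Sequence.IsRegular E rs},
    (rs.length : ℕ∞)

/-- `E` is Cohen-Macaulay, where depth is measured in `J`: either `E = 0`, or the depth of `E` in
`J` equals the Krull dimension of `E`. It is used for finitely generated modules in two cases:
`J` is the maximal ideal of a Noetherian local ring, or `J` is the unique maximal homogeneous ideal
of `G_I(A)`, with `(A, 𝔪)` Noetherian local, and `E` is graded. -/
def IsCohenMacaulay : Prop :=
  Nontrivial E → (depth R J E : WithBot ℕ∞) = Module.supportDim R E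

end CohenMacaulay

section Filtration

variable {A : Type u} [CommRing A] {I : Ideal A} {M : Type v} [AddCommGroup M] [Module A M]

/-- The dimension of a module as a natural number (`0` for the zero module). -/
noncomputable def dim (A : Type u) [CommRing A] (M : Type v) [AddCommGroup M] [Module A M] : ℕ :=
  ((Module.supportDim A M).unbotD 0).toNat

/-- `H(F, n)`, the length of `F_n / F_{n+1}`. -/
noncomputable def hilbertFunction (F : I.Filtration M) (n : ℕ) : ℕ :=
  (Module.length A (F.N n ⧸ (F.N (n + 1)).submoduleOf (F.N n))).toNat

/-- The Hilbert series `∑ H(F, n) zⁿ`. -/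
noncomputable def hilbertSeries (F : I.Filtration M) : PowerSeries ℤ :=
  PowerSeries.mk fun n => (hilbertFunction F n : ℤ)

/-- The integer polynomial `h` satisfies `∑ H(F, n) zⁿ = h(z) / (1 - z)ʳ` with `r = dim M`. -/
def IsHPolynomial (F : I.Filtration M) (h : Polynomial ℤ) : Prop :=
  (h : PowerSeries ℤ) = (1 - PowerSeries.X) ^ dim A M * hilbertSeries F

open Classical in
/-- The unique polynomial `h` with `∑ H(F, n) zⁿ = h(z) / (1 - z)ʳ`, where `r = dim M`
(and `0` if the series has no such form). -/
noncomputable def hPolynomial (F : I.Filtration M) : Polynomial ℤ :=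
  if H : ∃ h, IsHPolynomial F h then H.choose else 0

theorem IsHPolynomial.eq_hPolynomial {F : I.Filtration M} {h : Polynomial ℤ}
    (hh : IsHPolynomial F h) : h = hPolynomial F := by
  have H : ∃ h, IsHPolynomial F h := ⟨h, hh⟩
  have e : IsHPolynomial F (hPolynomial F) := by
    rw [hPolynomial, dif_pos H]
    exact H.choose_spec
  exact Polynomial.coe_injective ℤ (hh.trans e.symm)

/-- `e_i^I(M) = h^{(i)}(1) / i!`, where `h` is the `h`-polynomial of the `I`-adic filtration
`(Iⁿ M)` on `M`. The Hasse derivative is the `i`-th derivative divided by `i!`. -/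
noncomputable def hilbertCoeff (I : Ideal A) (M : Type v) [AddCommGroup M] [Module A M] (i : ℕ) :
    ℤ :=
  (Polynomial.hasseDeriv i (hPolynomial (I.stableFiltration (⊤ : Submodule A M)))).eval 1

/-- For `k ≤ l`, if `Iᵏ m ⊆ I^{n+k} M` then `Iˡ m ⊆ I^{n+l} M`. -/
theorem colon_mono {n k l : ℕ} (hkl : k ≤ l) {m : M}
    (h : ∀ a ∈ I ^ k, a • m ∈ I ^ (n + k) • (⊤ : Submodule A M)) :
    ∀ a ∈ I ^ l, a • m ∈ I ^ (n + l) • (⊤ : Submodule A M) := by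
  obtain ⟨d, rfl⟩ := Nat.exists_eq_add_of_le hkl
  intro a ha
  rw [add_comm k d, pow_add] at ha
  have e : n + (k + d) = d + (n + k) := by omega
  rw [e, pow_add, ← smul_eq_mul, Submodule.smul_assoc]
  refine Submodule.mul_induction_on ha ?_ ?_
  · intro b hb c hc
    rw [mul_smul]
    exact Submodule.smul_mem_smul hb (h c hc)
  · intro x y hx hy
    rw [add_smul]
    exact add_mem hx hy

/-- The `n`-th Ratliff-Rush submodule `⋃ₖ (I^{n+k} M :_M Iᵏ)`. -/
def ratliffRushSubmodule (I : Ideal A) (M : Type v) [AddCommGroup M] [Module A M] (n : ℕ) :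
    Submodule A M where
  carrier := {m | ∃ k : ℕ, ∀ a ∈ I ^ k, a • m ∈ I ^ (n + k) • (⊤ : Submodule A M)}
  add_mem' := by
    rintro x y ⟨k, hk⟩ ⟨l, hl⟩
    refine ⟨max k l, fun a ha => ?_⟩
    rw [smul_add]
    exact add_mem (colon_mono (le_max_left k l) hk a ha) (colon_mono (le_max_right k l) hl a ha)
  zero_mem' := ⟨0, fun a _ => by simp⟩
  smul_mem' := by
    rintro c x ⟨k, hk⟩
    refine ⟨k, fun a ha => ?_⟩
    rw [smul_comm]
    exact Submodule.smul_mem _ c (hk a ha)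

/-- The Ratliff-Rush filtration of `M` with respect to `I`. -/
def ratliffRush (I : Ideal A) (M : Type v) [AddCommGroup M] [Module A M] : I.Filtration M where
  N := ratliffRushSubmodule I M
  mono := by
    rintro n m ⟨k, hk⟩
    exact ⟨k, fun a ha => Submodule.smul_mono_left
      (Ideal.pow_le_pow_right (by omega)) (hk a ha)⟩
  smul_le := by
    intro n
    rw [Submodule.smul_le]
    rintro r hr m ⟨k, hk⟩
    refine ⟨k, fun a ha => ?_⟩
    have e : n + 1 + k = 1 + (n + k) := by omega
    rw [smul_comm, e, pow_add, pow_one, ← smul_eq_mul I, Submodule.smul_assoc]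
    exact Submodule.smul_mem_smul hr (hk a ha)

/-- The associated graded ring `G_I(A) = ⨁ Iⁿ / I^{n+1}`, as `A[It] / I A[It]`. -/
def AssocGradedRing (I : Ideal A) : Type u :=
  reesAlgebra I ⧸ I.map (algebraMap A (reesAlgebra I))

noncomputable instance (I : Ideal A) : CommRing (AssocGradedRing I) :=
  inferInstanceAs (CommRing (reesAlgebra I ⧸ I.map (algebraMap A (reesAlgebra I))))

/-- The quotient map `A[It] → G_I(A)`. -/
noncomputable def toAssocGradedRing (I : Ideal A) : reesAlgebra I →+* AssocGradedRing I :=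
  Ideal.Quotient.mk (I.map (algebraMap A (reesAlgebra I)))

theorem toAssocGradedRing_surjective (I : Ideal A) : Function.Surjective (toAssocGradedRing I) :=
  Ideal.Quotient.mk_surjective

theorem ker_toAssocGradedRing (I : Ideal A) :
    RingHom.ker (toAssocGradedRing I) = I.map (algebraMap A (reesAlgebra I)) :=
  Ideal.mk_ker

/-- The Rees module `⨁ F_n tⁿ` of a filtration, a module over the Rees algebra `A[It]`. -/
def ReesModule (F : I.Filtration M) : Type v := F.submodule

noncomputable instance (F : I.Filtration M) : AddCommGroup (ReesModule F) :=
  inferInstanceAs (AddCommGroup F.submodule)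

noncomputable instance (F : I.Filtration M) : Module (reesAlgebra I) (ReesModule F) :=
  inferInstanceAs (Module (reesAlgebra I) F.submodule)

/-- The submodule `⨁ F_{n+1} tⁿ` of the Rees module `⨁ F_n tⁿ`. -/
noncomputable def shiftSubmodule (F : I.Filtration M) :
    Submodule (reesAlgebra I) (ReesModule F) where
  carrier := {f | ∀ n, f.1.coeff n ∈ F.N (n + 1)}
  add_mem' hf hg n := Submodule.add_mem _ (hf n) (hg n)
  zero_mem' _ := Submodule.zero_mem _
  smul_mem' r f hf n := by
    change ((r : Polynomial A) • f.1).coeff n ∈ F.N (n + 1)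
    rw [PolynomialModule.smul_apply]
    apply Submodule.sum_mem
    rintro ⟨j, k⟩ e
    obtain rfl : j + k = n := by simpa using e
    exact F.pow_smul_le j (k + 1) (Submodule.smul_mem_smul (r.2 j) (hf k))

theorem smul_mem_shiftSubmodule (F : I.Filtration M) {r : reesAlgebra I}
    (hr : r ∈ I.map (algebraMap A (reesAlgebra I))) (f : ReesModule F) :
    r • f ∈ shiftSubmodule F := by
  refine Submodule.span_induction (p := fun r _ => r • f ∈ shiftSubmodule F) ?_ ?_ ?_ ?_ hr
  · rintro _ ⟨a, ha, rfl⟩ n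
    change ((algebraMap A (Polynomial A) a) • f.1).coeff n ∈ F.N (n + 1)
    rw [algebraMap_smul]
    exact F.smul_le n (Submodule.smul_mem_smul ha (f.2 n))
  · rw [zero_smul]
    exact zero_mem _
  · intro x y _ _ hx hy
    rw [add_smul]
    exact add_mem hx hy
  · intro a x _ hx
    rw [smul_eq_mul, mul_smul]
    exact Submodule.smul_mem _ a hx

/-- The associated graded module `G_F(M) = ⨁ F_n / F_{n+1}` of a filtration, as the quotient of the
Rees module `⨁ F_n tⁿ` by `⨁ F_{n+1} tⁿ`. -/
def AssocGradedModule (F : I.Filtration M) : Type v :=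
  ReesModule F ⧸ shiftSubmodule F

noncomputable instance (F : I.Filtration M) : AddCommGroup (AssocGradedModule F) :=
  inferInstanceAs (AddCommGroup (ReesModule F ⧸ shiftSubmodule F))

noncomputable instance (F : I.Filtration M) : Module (reesAlgebra I) (AssocGradedModule F) :=
  inferInstanceAs (Module (reesAlgebra I) (ReesModule F ⧸ shiftSubmodule F))

/-- The quotient map from the Rees module of `F` to `G_F(M)`. -/
noncomputable def toAssocGradedModule (F : I.Filtration M) :
    ReesModule F →ₗ[reesAlgebra I] AssocGradedModule F :=
  (shiftSubmodule F).mkQ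

theorem toAssocGradedModule_surjective (F : I.Filtration M) :
    Function.Surjective (toAssocGradedModule F) :=
  (shiftSubmodule F).mkQ_surjective

theorem ker_toAssocGradedModule (F : I.Filtration M) :
    LinearMap.ker (toAssocGradedModule F) = shiftSubmodule F :=
  (shiftSubmodule F).ker_mkQ

theorem isTorsionBySet_assocGradedModule (F : I.Filtration M) :
    Module.IsTorsionBySet (reesAlgebra I) (AssocGradedModule F)
      (I.map (algebraMap A (reesAlgebra I)) : Set (reesAlgebra I)) := by
  rintro x ⟨r, hr⟩
  obtain ⟨f, rfl⟩ := toAssocGradedModule_surjective F x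
  change r • toAssocGradedModule F f = 0
  rw [← map_smul, ← LinearMap.mem_ker, ker_toAssocGradedModule]
  exact smul_mem_shiftSubmodule F hr f

/-- `G_F(M)` is a module over `G_I(A)`, by the action induced from that of `A[It]`. -/
noncomputable instance (F : I.Filtration M) :
    Module (AssocGradedRing I) (AssocGradedModule F) :=
  (isTorsionBySet_assocGradedModule F).module

theorem toAssocGradedRing_smul (F : I.Filtration M) (r : reesAlgebra I)
    (x : AssocGradedModule F) : toAssocGradedRing I r • x = r • x :=
  rfl

/-- The maximal homogeneous ideal `𝔪/I ⊕ ⨁_{n > 0} Iⁿ / I^{n+1}` of `G_I(A)`: the image of the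
ideal of `A[It]` of the elements with constant term in `𝔪`. -/
noncomputable def homogeneousMaximalIdeal [IsLocalRing A] (I : Ideal A) :
    Ideal (AssocGradedRing I) :=
  ((maximalIdeal A).comap
    ((Polynomial.constantCoeff : Polynomial A →+* A).comp
      (reesAlgebra I).val.toRingHom)).map (toAssocGradedRing I)

/-- The graded `G_I(A)`-module `G_F(M)` has minimal multiplicity: it is Cohen-Macaulay and its
`h`-polynomial has degree at most one. -/
def HasMinimalMultiplicity [IsLocalRing A] (F : I.Filtration M) : Prop :=
  IsCohenMacaulay (AssocGradedRing I) (homogeneousMaximalIdeal I) (AssocGradedModule F) ∧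
    ∃ h : Polynomial ℤ, IsHPolynomial F h ∧ h.natDegree ≤ 1

/-- `I` is an ideal of definition for `M`: a proper ideal with `𝔪ⁿ M ⊆ I M` for some `n`. -/
def IsIdealOfDefinition [IsLocalRing A] (I : Ideal A) (M : Type v) [AddCommGroup M] [Module A M] :
    Prop :=
  I ≤ maximalIdeal A ∧
    ∃ n : ℕ, maximalIdeal A ^ n • (⊤ : Submodule A M) ≤ I • (⊤ : Submodule A M)

end Filtration

end RatliffRush

/-! Write F for the Ratliff–Rush filtration. It agrees with the I-adic one in high degrees, so the
two colength polynomials, and hence the two values of e₂, coincide. If the h-polynomial of F has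
degree at most one, its second derivative vanishes and e₂ = 0.

For the converse, take x, y ∈ I^c, regular on M, with x superficial and I^(n+c)M = (x, y)IⁿM for
large n; here c may be arbitrarily large. For F the relation (F_(n+c) : x) = F_n holds in every
degree (`mem_of_smul_mem_ratliffRush`). The Koszul complex on x, y then gives, with d_n =
λ(F_(n+2c)/(x, y)F_(n+c)), λ(M/F_(n+2c)) + d_n + λ(M/F_n) = λ(M/(x, y)M) + 2λ(M/F_(n+c))
(`relLength_koszul`, `colength_add`). Take c so large that λ(M/F_n) is a polynomial for n ≥ c. High
degrees, where d_n = 0, give λ(M/(x, y)M) = e₀c². At n = 0 we have λ(M/F_0) = 0, while the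
polynomial takes the value e₂ there; so e₂ = 0 forces d_0 = 0. Multiplying by Iⁿ gives d_n = 0 for
all n.

Both halves of minimal multiplicity follow. With d_n = 0 the identity makes λ(M/F_n) polynomial for
every n, so the h-polynomial is linear. Also the initial forms of x, y are regular on the associated
graded module, which is finite over a polynomial ring in two variables over an Artinian ring, so its
depth and dimension are both two.

The pair x, y comes from `exists_parameters`: the Hilbert function has degree at most one, and each
filter-regular homogeneous element, found by homogeneous prime avoidance, lowers that degree by one.
-/

namespace RatliffRush

open IsLocalRing

universe u v w

/-! ### Lengths of subquotients. -/

section RelativeLength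

variable {A : Type u} [CommRing A] {M : Type v} [AddCommGroup M] [Module A M]
  {N : Type w} [AddCommGroup N] [Module A N]

/-- The length of `V / W`, for submodules `W ≤ V`. -/
noncomputable def relLength (V W : Submodule A M) : ℕ∞ :=
  Module.length A (V ⧸ W.submoduleOf V)

theorem length_quotient_ker_comp_subtype {P : Type*} [AddCommGroup P] [Module A P]
    (V : Submodule A N) (f : N →ₗ[A] P) :
    relLength V (LinearMap.ker f) = Module.length A (V.map f) := by
  have e : (LinearMap.ker f).submoduleOf V = LinearMap.ker (f ∘ₗ V.subtype) := by
    rw [LinearMap.ker_comp]; rfl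
  have r : V.map f = LinearMap.range (f ∘ₗ V.subtype) := by
    rw [LinearMap.range_comp, Submodule.range_subtype]
  rw [relLength, e, r]
  exact (LinearMap.quotKerEquivRange (f ∘ₗ V.subtype)).length_eq

theorem relLength_inf_right (V W : Submodule A M) : relLength V (V ⊓ W) = relLength V W := by
  have : (V ⊓ W).submoduleOf V = W.submoduleOf V := by
    ext x; simp [Submodule.submoduleOf]
  rw [relLength, relLength, this]

/-- The first isomorphism theorem for relative lengths. -/
theorem relLength_comap (f : N →ₗ[A] M) (V : Submodule A N) (W : Submodule A M) :
    relLength V (W.comap f) = relLength (V.map f ⊔ W) W := by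
  have h1 := length_quotient_ker_comp_subtype V (W.mkQ ∘ₗ f)
  have h2 := length_quotient_ker_comp_subtype (V.map f ⊔ W) W.mkQ
  rw [LinearMap.ker_comp, Submodule.ker_mkQ] at h1
  rw [Submodule.ker_mkQ, Submodule.map_sup] at h2
  rw [h1, h2, Submodule.map_comp, (Submodule.mkQ_map_self W), sup_bot_eq]

theorem relLength_eq_length_map (V W : Submodule A M) :
    relLength V W = Module.length A (V.map W.mkQ) := by
  rw [← length_quotient_ker_comp_subtype, Submodule.ker_mkQ]

theorem length_eq_length_inf_ker_add_length_map (f : N →ₗ[A] M) (U : Submodule A N) :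
    Module.length A U =
      Module.length A (U ⊓ LinearMap.ker f : Submodule A N) + Module.length A (U.map f) := by
  refine Module.length_eq_add_of_exact (Submodule.inclusion inf_le_left) (f.submoduleMap U)
    (Submodule.inclusion_injective _) (f.submoduleMap_surjective U) ?_
  intro x
  constructor
  · intro h
    refine ⟨⟨x.1, x.2, ?_⟩, rfl⟩
    simpa using congrArg Subtype.val h
  · rintro ⟨y, rfl⟩
    exact Subtype.ext y.2.2

theorem map_factor_map_mkQ {W V : Submodule A M} (h : W ≤ V) (U : Submodule A M) :
    (U.map W.mkQ).map (Submodule.factor h) = U.map V.mkQ := by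
  rw [← Submodule.map_comp, Submodule.factor_comp_mk]

theorem relLength_add {U V W : Submodule A M} (hVU : V ≤ U) (hWV : W ≤ V) :
    relLength U W = relLength U V + relLength V W := by
  rw [relLength_eq_length_map U W, relLength_eq_length_map U V, relLength_eq_length_map V W,
    length_eq_length_inf_ker_add_length_map (Submodule.factor hWV), map_factor_map_mkQ, add_comm]
  have : U.map W.mkQ ⊓ LinearMap.ker (Submodule.factor hWV) = V.map W.mkQ := by
    ext x
    obtain ⟨x, rfl⟩ := W.mkQ_surjective x
    rw [Submodule.mem_inf, LinearMap.mem_ker, Submodule.factor_mk, Submodule.mkQ_apply V,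
      Submodule.Quotient.mk_eq_zero]
    constructor
    · exact fun h => ⟨x, h.2, rfl⟩
    · rintro ⟨y, hy, e⟩
      refine ⟨⟨y, hVU hy, e⟩, ?_⟩
      have := (Submodule.Quotient.eq W).1 e
      have h2 := V.sub_mem hy (hWV this)
      rwa [sub_sub_cancel] at h2
  rw [this]

theorem relLength_eq_zero_iff {V W : Submodule A M} : relLength V W = 0 ↔ V ≤ W := by
  rw [relLength_eq_length_map, Module.length_eq_zero_iff, Submodule.subsingleton_iff_eq_bot,
    eq_bot_iff, Submodule.map_le_iff_le_comap, Submodule.comap_bot, Submodule.ker_mkQ]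

theorem relLength_mono {V V' W W' : Submodule A M} (hV : V ≤ V') (hW : W' ≤ W) :
    relLength V W ≤ relLength V' W' := by
  refine le_trans (b := relLength V' W) ?_ ?_
  · rw [relLength_eq_length_map, relLength_eq_length_map]
    exact Module.length_le_of_injective _ (Submodule.inclusion_injective (Submodule.map_mono hV))
  · rw [relLength_eq_length_map, relLength_eq_length_map, ← map_factor_map_mkQ hW]
    exact Module.length_le_of_surjective _ (LinearMap.submoduleMap_surjective _ _)

theorem relLength_top (W : Submodule A M) : relLength ⊤ W = Module.length A (M ⧸ W) := by
  have := length_quotient_ker_comp_subtype ⊤ W.mkQ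
  rw [Submodule.ker_mkQ, Submodule.map_top, Submodule.range_mkQ, Module.length_top] at this
  exact this

/-- Kernel and cokernel of a map `V / W → V' / W'` have lengths balancing those of the source and
the target. -/
theorem relLength_add_relLength_of_map (f : N →ₗ[A] M) {V W : Submodule A N}
    {V' W' : Submodule A M} (hWV : W ≤ V) (hWV' : W' ≤ V') (hV : V ≤ V'.comap f)
    (hW : W ≤ W'.comap f) :
    relLength V W + relLength V' (W' ⊔ V.map f) =
      relLength V' W' + relLength (V ⊓ W'.comap f) W := by
  rw [relLength_add (U := V) (V := V ⊓ W'.comap f) inf_le_left (le_inf hWV hW),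
    relLength_add (U := V') (V := W' ⊔ V.map f) (sup_le hWV' (Submodule.map_le_iff_le_comap.2 hV))
    le_sup_left, relLength_inf_right, relLength_comap, sup_comm (V.map f)]
  ring

end RelativeLength

/-! ### Integer sequences that are eventually polynomial. -/

section Differences

/-- The forward difference of an integer sequence. -/
def diff (f : ℕ → ℤ) (n : ℕ) : ℤ := f (n + 1) - f n

/-- The `k`-th difference of the sequence vanishes eventually: for large arguments it is
polynomial of degree less than `k`. -/
def EventuallyPoly (k : ℕ) (f : ℕ → ℤ) : Prop := ∃ N, ∀ n ≥ N, diff^[k] f n = 0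

theorem iterate_diff_add (k : ℕ) (f g : ℕ → ℤ) :
    diff^[k] (f + g) = diff^[k] f + diff^[k] g := by
  induction k generalizing f g with
  | zero => rfl
  | succ k ih =>
    rw [Function.iterate_succ_apply, Function.iterate_succ_apply, Function.iterate_succ_apply,
      ← ih]
    congr 1
    ext n
    simp only [diff, Pi.add_apply]
    ring

theorem iterate_diff_neg (k : ℕ) (f : ℕ → ℤ) : diff^[k] (-f) = -diff^[k] f := by
  induction k generalizing f with
  | zero => rfl
  | succ k ih =>
    rw [Function.iterate_succ_apply, Function.iterate_succ_apply, ← ih]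
    congr 1
    ext n
    simp only [diff, Pi.neg_apply]
    ring

theorem iterate_diff_shift (k a : ℕ) (f : ℕ → ℤ) (n : ℕ) :
    diff^[k] (fun m => f (m + a)) n = diff^[k] f (n + a) := by
  induction k generalizing f with
  | zero => rfl
  | succ k ih =>
    rw [Function.iterate_succ_apply, Function.iterate_succ_apply, ← ih]
    have : (diff fun m => f (m + a)) = fun m => diff f (m + a) := by
      ext n
      simp only [diff]
      congr 2
      omega
    rw [this]

theorem iterate_diff_congr {f g : ℕ → ℤ} {N : ℕ} (h : ∀ n ≥ N, f n = g n) (k : ℕ) :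
    ∀ n ≥ N, diff^[k] f n = diff^[k] g n := by
  induction k generalizing f g with
  | zero => exact h
  | succ k ih =>
    refine ih fun n hn => ?_
    rw [diff, diff, h n hn, h (n + 1) (by omega)]

namespace EventuallyPoly

variable {k : ℕ} {f g : ℕ → ℤ}

theorem add (hf : EventuallyPoly k f) (hg : EventuallyPoly k g) : EventuallyPoly k (f + g) := by
  obtain ⟨N, hN⟩ := hf
  obtain ⟨N', hN'⟩ := hg
  refine ⟨max N N', fun n hn => ?_⟩
  rw [iterate_diff_add, Pi.add_apply, hN n (by omega), hN' n (by omega), add_zero]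

theorem neg (hf : EventuallyPoly k f) : EventuallyPoly k (-f) := by
  obtain ⟨N, hN⟩ := hf
  refine ⟨N, fun n hn => ?_⟩
  rw [iterate_diff_neg, Pi.neg_apply, hN n hn, neg_zero]

theorem shift_iff (a : ℕ) : EventuallyPoly k (fun n => f (n + a)) ↔ EventuallyPoly k f := by
  constructor
  · rintro ⟨N, hN⟩
    refine ⟨N + a, fun n hn => ?_⟩
    have := hN (n - a) (by omega)
    rwa [iterate_diff_shift, Nat.sub_add_cancel (by omega)] at this
  · rintro ⟨N, hN⟩
    refine ⟨N, fun n hn => ?_⟩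
    rw [iterate_diff_shift]
    exact hN _ (by omega)

theorem congr (hf : EventuallyPoly k f) {N : ℕ} (h : ∀ n ≥ N, f n = g n) :
    EventuallyPoly k g := by
  obtain ⟨N', hN'⟩ := hf
  refine ⟨max N N', fun n hn => ?_⟩
  rw [← iterate_diff_congr h k n (by omega), hN' n (by omega)]

theorem succ_iff : EventuallyPoly (k + 1) f ↔ EventuallyPoly k (diff f) := Iff.rfl

theorem shift_sub (hf : EventuallyPoly (k + 1) f) (a : ℕ) :
    EventuallyPoly k (fun n => f (n + a) - f n) := by
  induction a with
  | zero =>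
    have hd : EventuallyPoly k (diff f) := hf
    refine EventuallyPoly.congr (N := 0) (hd.add hd.neg) ?_
    intro n _
    simp
  | succ a ih =>
    refine EventuallyPoly.congr (N := 0) (ih.add ((shift_iff a).2 (succ_iff.1 hf))) ?_
    intro n _
    simp only [diff, Pi.add_apply, ← add_assoc]
    ring

end EventuallyPoly

theorem eventually_pos_of_diff {f : ℕ → ℤ} (h : ∃ N, ∀ n ≥ N, 1 ≤ diff f n) :
    ∃ N, ∀ n ≥ N, 1 ≤ f n := by
  obtain ⟨N, hN⟩ := h
  have key : ∀ n, f N + n ≤ f (N + n) := by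
    intro n
    induction n with
    | zero => simp
    | succ n ih =>
      have := hN (N + n) (by omega)
      simp only [diff] at this
      push_cast
      rw [← add_assoc N n 1]
      linarith
  refine ⟨N + (1 - f N).toNat, fun n hn => ?_⟩
  have := key (n - N)
  rw [Nat.add_sub_cancel' (by omega)] at this
  omega

theorem eventually_pos_of_iterate_diff (k : ℕ) {f : ℕ → ℤ}
    (h : ∃ N, ∀ n ≥ N, 1 ≤ diff^[k] f n) : ∃ N, ∀ n ≥ N, 1 ≤ f n := by
  induction k generalizing f with
  | zero => exact h
  | succ k ih => exact eventually_pos_of_diff (ih h)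

theorem iterate_diff_three_sq (c : ℤ) (k : ℕ) (n : ℕ) :
    diff^[k + 3] (fun m : ℕ => c * (m : ℤ) ^ 2) n = 0 := by
  have h3 : diff^[3] (fun m : ℕ => c * (m : ℤ) ^ 2) = 0 := by
    ext n
    simp only [Function.iterate_succ_apply, Function.iterate_zero, id, diff, Pi.zero_apply]
    push_cast
    ring
  have h0 : ∀ k, diff^[k] 0 = 0 := by
    intro k
    have := iterate_diff_add k 0 0
    simpa using this
  rw [Function.iterate_add_apply, h3, h0]
  rfl

theorem constant_of_diff_eq_zero {f : ℕ → ℤ} {N : ℕ} (h : ∀ n ≥ N, diff f n = 0) :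
    ∀ n ≥ N, f n = f N := by
  intro n hn
  induction n, hn using Nat.le_induction with
  | base => rfl
  | succ n hn ih =>
    have := h n hn
    rw [diff] at this
    omega

/-- A nonnegative sequence that is eventually polynomial and has quadratic growth is eventually
polynomial of degree at most two. -/
theorem EventuallyPoly.of_le_sq {k : ℕ} {f : ℕ → ℤ} {c : ℤ} (hf : EventuallyPoly k f)
    (h0 : ∀ n, 0 ≤ f n) (h : ∀ n, f n ≤ c * (n : ℤ) ^ 2) : EventuallyPoly 3 f := by
  -- The difference of order k + 3 is eventually constant. A negative constant makes f eventually
  -- negative, a positive one makes f outgrow c n²; so it is zero.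
  have step : ∀ k, EventuallyPoly (k + 4) f → EventuallyPoly (k + 3) f := by
    rintro k ⟨N, hN⟩
    have hc := constant_of_diff_eq_zero (f := diff^[k + 3] f) (N := N) (fun n hn => by
      have : diff^[(k + 3) + 1] f n = 0 := hN n hn
      rwa [Function.iterate_succ_apply'] at this)
    rcases lt_trichotomy (diff^[k + 3] f N) 0 with hlt | heq | hgt
    · exfalso
      obtain ⟨N', hN'⟩ := eventually_pos_of_iterate_diff (k + 3) (f := -f) ⟨N, fun n hn => by
        rw [iterate_diff_neg, Pi.neg_apply, hc n hn]
        omega⟩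
      have h1 := hN' N' le_rfl
      have h2 := h0 N'
      rw [Pi.neg_apply] at h1
      omega
    · exact ⟨N, fun n hn => (hc n hn).trans heq⟩
    · exfalso
      obtain ⟨N', hN'⟩ := eventually_pos_of_iterate_diff (k + 3)
        (f := f + fun m : ℕ => (-c) * (m : ℤ) ^ 2) ⟨N, fun n hn => by
          rw [iterate_diff_add, Pi.add_apply, iterate_diff_three_sq, hc n hn]
          omega⟩
      have h1 := hN' N' le_rfl
      have h2 := h N'
      simp only [Pi.add_apply] at h1
      linarith
  have up : ∀ k, EventuallyPoly k f → EventuallyPoly (k + 1) f := by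
    rintro k ⟨N, hN⟩
    refine ⟨N, fun n hn => ?_⟩
    rw [Function.iterate_succ_apply', diff, hN n hn, hN (n + 1) (by omega), sub_zero]
  have hk : EventuallyPoly (k + 3) f := up _ (up _ (up _ hf))
  clear hf
  induction k with
  | zero => simpa using hk
  | succ k ih => exact ih (step k (by rwa [add_right_comm] at hk))

end Differences

/-! ### Hilbert functions of graded subquotients of the Rees module. -/

section FiltrationPairs

variable {A : Type u} [CommRing A] {I : Ideal A} {M : Type v} [AddCommGroup M] [Module A M]

theorem filtration_smul_mem (F : I.Filtration M) {x : A} {a n : ℕ} (hx : x ∈ I ^ a) {w : M}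
    (hw : w ∈ F.N n) : x • w ∈ F.N (n + a) := by
  rw [add_comm]
  exact F.pow_smul_le a n (Submodule.smul_mem_smul hx hw)

/-- The kernel of multiplication by `x ∈ Iᵃ`, from `V` to `V / W` shifted by `a`. -/
def kernelFiltration (V W : I.Filtration M) (x : A) (a : ℕ) : I.Filtration M where
  N n := V.N n ⊓ (W.N (n + a)).comap (LinearMap.lsmul A M x)
  mono n := by
    refine inf_le_inf (V.mono n) (Submodule.comap_mono ?_)
    rw [add_right_comm]
    exact W.mono _
  smul_le n := by
    rw [Submodule.smul_le]
    rintro r hr w ⟨hw, hw'⟩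
    refine ⟨V.smul_le n (Submodule.smul_mem_smul hr hw), ?_⟩
    change x • r • w ∈ W.N (n + 1 + a)
    rw [smul_comm, add_right_comm]
    exact W.smul_le _ (Submodule.smul_mem_smul hr hw')

/-- The image `W + x V` of multiplication by `x ∈ Iᵃ`, from `V` shifted by `-a`. -/
def imageFiltration (V W : I.Filtration M) (x : A) (a : ℕ) : I.Filtration M where
  -- Below degree a the subtraction truncates to V_0. This is harmless, since x V_0 ⊆ V_a ⊆ V_n
  -- there.
  N n := W.N n ⊔ (V.N (n - a)).map (LinearMap.lsmul A M x)
  mono n := sup_le_sup (W.mono n) (Submodule.map_mono (V.antitone (by omega)))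
  smul_le n := by
    rw [Submodule.smul_sup]
    refine sup_le_sup (W.smul_le n) ?_
    rw [← Submodule.map_smul'']
    refine Submodule.map_mono ((V.smul_le _).trans (V.antitone (by omega)))

theorem imageFiltration_le {V W : I.Filtration M} (hWV : W ≤ V) {x : A} {a : ℕ}
    (hx : x ∈ I ^ a) : imageFiltration V W x a ≤ V := by
  intro n
  refine sup_le (hWV n) ?_
  rw [Submodule.map_le_iff_le_comap]
  intro w hw
  exact V.antitone (by omega) (filtration_smul_mem V hx hw)

theorem le_imageFiltration (V W : I.Filtration M) (x : A) (a : ℕ) :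
    W ≤ imageFiltration V W x a := fun _ => le_sup_left

theorem le_kernelFiltration {V W : I.Filtration M} (hWV : W ≤ V) {x : A} {a : ℕ}
    (hx : x ∈ I ^ a) : W ≤ kernelFiltration V W x a :=
  fun n _ hw => ⟨hWV n hw, filtration_smul_mem W hx hw⟩

theorem kernelFiltration_le (V W : I.Filtration M) (x : A) (a : ℕ) :
    kernelFiltration V W x a ≤ V := fun _ => inf_le_left

/-- The Hilbert function of the graded module `⨁ V_n / W_n`. -/
noncomputable def pairHilbert (V W : I.Filtration M) (n : ℕ) : ℤ :=
  ((relLength (V.N n) (W.N n)).toNat : ℤ)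

/-- Alternating sum of lengths along the kernel and cokernel of x : V_n/W_n → V_(n+a)/W_(n+a). -/
theorem pairHilbert_add (V W : I.Filtration M) (hWV : W ≤ V)
    (hfin : ∀ n, relLength (V.N n) (W.N n) ≠ ⊤) {x : A} {a : ℕ} (hx : x ∈ I ^ a) (n : ℕ) :
    pairHilbert V W n + pairHilbert V (imageFiltration V W x a) (n + a) =
      pairHilbert V W (n + a) + pairHilbert (kernelFiltration V W x a) W n := by
  have key := relLength_add_relLength_of_map (LinearMap.lsmul A M x) (V := V.N n) (W := W.N n)
    (V' := V.N (n + a)) (W' := W.N (n + a)) (hWV n) (hWV (n + a))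
    (fun w hw => filtration_smul_mem V hx hw) (fun w hw => filtration_smul_mem W hx hw)
  have e : (imageFiltration V W x a).N (n + a) =
      W.N (n + a) ⊔ (V.N n).map (LinearMap.lsmul A M x) := by
    change _ ⊔ Submodule.map _ (V.N (n + a - a)) = _
    rw [Nat.add_sub_cancel]
  rw [← e] at key
  change _ = _ + relLength ((kernelFiltration V W x a).N n) _ at key
  have h1 : relLength (V.N (n + a)) ((imageFiltration V W x a).N (n + a)) ≠ ⊤ :=
    ne_top_of_le_ne_top (hfin (n + a)) (relLength_mono le_rfl (le_imageFiltration V W x a _))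
  have h2 : relLength ((kernelFiltration V W x a).N n) (W.N n) ≠ ⊤ :=
    ne_top_of_le_ne_top (hfin n) (relLength_mono (kernelFiltration_le V W x a n) le_rfl)
  have := congrArg ENat.toNat key
  rw [ENat.toNat_add (hfin n) h1, ENat.toNat_add (hfin _) h2] at this
  simp only [pairHilbert]
  exact_mod_cast this

theorem le_stableFiltration_stable [IsNoetherianRing A] [Module.Finite A M] {V : I.Filtration M}
    (hV : V ≤ I.stableFiltration ⊤) : V.Stable :=
  (I.stableFiltration_stable ⊤).of_le hV

/-- The Hilbert function of a graded subquotient of the Rees module is eventually polynomial. -/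
theorem eventuallyPoly_pairHilbert [IsNoetherianRing A] [Module.Finite A M] (L : List A)
    (J : Ideal A) (hI : I = J ⊔ Ideal.span {c | c ∈ L}) (V W : I.Filtration M) (hWV : W ≤ V)
    (hV : V ≤ I.stableFiltration ⊤) (hfin : ∀ n, relLength (V.N n) (W.N n) ≠ ⊤)
    (hJ : ∀ c ∈ J, ∀ n, ∀ w ∈ V.N n, c • w ∈ W.N (n + 1)) :
    EventuallyPoly L.length (pairHilbert V W) := by
  -- The Hilbert–Serre induction: J holds elements already known to kill ⨁ V_n/W_n, and L the
  -- remaining generators of I. With none left, stability gives V_(n+1) = I V_n ⊆ W_(n+1) for large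
  -- n.
  induction L generalizing J V W with
  | nil =>
    have hJ' : I = J := by simpa using hI
    obtain ⟨N, hN⟩ := le_stableFiltration_stable hV
    refine ⟨N + 1, fun n hn => ?_⟩
    obtain ⟨n, rfl⟩ : ∃ m, n = m + 1 := ⟨n - 1, by omega⟩
    have : relLength (V.N (n + 1)) (W.N (n + 1)) = 0 := by
      rw [relLength_eq_zero_iff, ← hN n (by omega), Submodule.smul_le]
      exact fun c hc w hw => hJ c (hJ' ▸ hc) n w hw
    simp [pairHilbert, this]
  | cons c L ih =>
    have hcI : c ∈ I := by
      rw [hI]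
      exact Ideal.mem_sup_right (Ideal.subset_span (by simp))
    have hc1 : c ∈ I ^ 1 := by rwa [pow_one]
    have hJ' : I = (J ⊔ Ideal.span {c}) ⊔ Ideal.span {c | c ∈ L} := by
      rw [sup_assoc, ← Ideal.span_union]
      convert hI using 3
      ext d
      simp
    -- Kernel and cokernel of c are killed by J and by c, and the difference of the Hilbert function
    -- is the cokernel's minus the kernel's.
    have hK := ih _ hJ' (kernelFiltration V W c 1) W (le_kernelFiltration hWV hc1)
      ((kernelFiltration_le V W c 1).trans hV)
      (fun n => ne_top_of_le_ne_top (hfin n)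
        (relLength_mono (kernelFiltration_le V W c 1 n) le_rfl)) (by
        intro d hd n w hw
        obtain ⟨d', hd', e, he, rfl⟩ := Submodule.mem_sup.1 hd
        obtain ⟨r, rfl⟩ := Ideal.mem_span_singleton'.1 he
        rw [add_smul]
        refine add_mem (hJ d' hd' n w hw.1) ?_
        rw [mul_smul]
        exact Submodule.smul_mem _ _ hw.2)
    have hC := ih _ hJ' V (imageFiltration V W c 1) (imageFiltration_le hWV hc1) hV
      (fun n => ne_top_of_le_ne_top (hfin n)
        (relLength_mono le_rfl (le_imageFiltration V W c 1 n))) (by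
        intro d hd n w hw
        obtain ⟨d', hd', e, he, rfl⟩ := Submodule.mem_sup.1 hd
        obtain ⟨r, rfl⟩ := Ideal.mem_span_singleton'.1 he
        rw [add_smul]
        refine add_mem (le_imageFiltration V W c 1 _ (hJ d' hd' n w hw)) ?_
        rw [mul_smul]
        exact Submodule.smul_mem _ _ (Submodule.mem_sup_right ⟨w, hw, rfl⟩))
    rw [List.length_cons, EventuallyPoly.succ_iff]
    refine EventuallyPoly.congr (N := 0)
      (((EventuallyPoly.shift_iff 1).2 hC).add hK.neg) fun n _ => ?_
    have := pairHilbert_add V W hWV hfin hc1 n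
    simp only [Pi.add_apply, Pi.neg_apply, diff]
    linarith

end FiltrationPairs

/-! ### Avoiding primes of the Rees algebra by homogeneous elements. -/

section HomogeneousPrimeAvoidance

open Polynomial

variable {A : Type u} [CommRing A] {I : Ideal A}

/-- The monomial `c tⁿ` lies in the ideal `P` of the Rees algebra. -/
def MonomialMem (P : Ideal (reesAlgebra I)) (n : ℕ) (c : A) : Prop :=
  ∃ r ∈ P, (r : A[X]) = monomial n c

/-- The element `c tⁿ` of the Rees algebra. -/
noncomputable def reesMonomial (n : ℕ) (c : A) (hc : c ∈ I ^ n) : reesAlgebra I :=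
  ⟨monomial n c, reesAlgebra.monomial_mem.2 hc⟩

theorem monomialMem_iff {P : Ideal (reesAlgebra I)} {n : ℕ} {c : A} (hc : c ∈ I ^ n) :
    MonomialMem P n c ↔ reesMonomial n c hc ∈ P := by
  constructor
  · rintro ⟨r, hr, e⟩
    rwa [show reesMonomial n c hc = r from Subtype.ext e.symm]
  · exact fun h => ⟨_, h, rfl⟩

theorem reesMonomial_mul {i j : ℕ} {c d : A} (hc : c ∈ I ^ i) (hd : d ∈ I ^ j) :
    reesMonomial i c hc * reesMonomial j d hd =
      reesMonomial (i + j) (c * d) (by rw [pow_add]; exact Ideal.mul_mem_mul hc hd) :=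
  Subtype.ext (monomial_mul_monomial i j c d)

theorem reesMonomial_pow {i : ℕ} {c : A} (hc : c ∈ I ^ i) (k : ℕ) :
    reesMonomial i c hc ^ k =
      reesMonomial (i * k) (c ^ k) (by rw [pow_mul]; exact Ideal.pow_mem_pow hc k) :=
  Subtype.ext (monomial_pow i c k)

theorem reesMonomial_add {i : ℕ} {c d : A} (hc : c ∈ I ^ i) (hd : d ∈ I ^ i) :
    reesMonomial i c hc + reesMonomial i d hd = reesMonomial i (c + d) (add_mem hc hd) :=
  Subtype.ext (map_add (monomial i) c d).symm

/-- Multiply witnesses, one for each Q; the product stays outside the prime P. Starting from a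
degree-one element outside P keeps the degree positive. -/
theorem exists_monomialMem_of_forall (P : Ideal (reesAlgebra I)) [hP : P.IsPrime]
    (hrel : ∃ c ∈ I, ¬ MonomialMem P 1 c) (T : Finset (Ideal (reesAlgebra I)))
    (hT : ∀ Q ∈ T, ∃ n, ∃ c ∈ I ^ n, MonomialMem Q n c ∧ ¬ MonomialMem P n c) :
    ∃ b ≥ 1, ∃ u ∈ I ^ b, ¬ MonomialMem P b u ∧ ∀ Q ∈ T, MonomialMem Q b u := by
  classical
  induction T using Finset.induction_on with
  | empty =>
    obtain ⟨c, hc, h⟩ := hrel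
    exact ⟨1, le_rfl, c, by rwa [pow_one], h, by simp⟩
  | insert Q T hQT ih =>
    obtain ⟨b, hb, u, hu, huP, huT⟩ := ih fun Q' hQ' => hT Q' (Finset.mem_insert_of_mem hQ')
    obtain ⟨n, c, hc, hcQ, hcP⟩ := hT Q (Finset.mem_insert_self _ _)
    have hcu : c * u ∈ I ^ (n + b) := by rw [pow_add]; exact Ideal.mul_mem_mul hc hu
    refine ⟨n + b, by omega, c * u, hcu, ?_, ?_⟩
    · rw [monomialMem_iff hcu, ← reesMonomial_mul hc hu]
      rw [monomialMem_iff hu] at huP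
      rw [monomialMem_iff hc] at hcP
      exact fun h => (hP.mem_or_mem h).elim hcP huP
    · intro Q' hQ'
      rw [monomialMem_iff hcu, ← reesMonomial_mul hc hu]
      rcases Finset.mem_insert.1 hQ' with rfl | hQ'
      · exact Ideal.mul_mem_right _ _ ((monomialMem_iff hc).1 hcQ)
      · exact Ideal.mul_mem_left _ _ ((monomialMem_iff hu).1 (huT Q' hQ'))

/-- Homogeneous prime avoidance in the Rees algebra. -/
theorem exists_forall_not_monomialMem (S : Finset (Ideal (reesAlgebra I)))
    (hS : ∀ P ∈ S, P.IsPrime) (hrel : ∀ P ∈ S, ∃ c ∈ I, ¬ MonomialMem P 1 c) :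
    ∃ a ≥ 1, ∃ x ∈ I ^ a, ∀ P ∈ S, ¬ MonomialMem P a x := by
  classical
  induction S using Finset.strongInduction with
  | H S ih =>
    rcases S.eq_empty_or_nonempty with rfl | ⟨P, hP⟩
    · exact ⟨1, le_rfl, 0, zero_mem _, by simp⟩
    have := hS P hP
    -- If every homogeneous element of Q lies in P, avoiding P already avoids Q, and Q can be
    -- dropped.
    by_cases hinc : ∃ Q ∈ S.erase P, ∀ n, ∀ c ∈ I ^ n, MonomialMem Q n c → MonomialMem P n c
    · obtain ⟨Q, hQ, hQP⟩ := hinc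
      obtain ⟨hne, hQS⟩ := Finset.mem_erase.1 hQ
      obtain ⟨a, ha, x, hx, h⟩ := ih (S.erase Q) (Finset.erase_ssubset hQS)
        (fun P' h => hS P' (Finset.mem_of_mem_erase h))
        (fun P' h => hrel P' (Finset.mem_of_mem_erase h))
      refine ⟨a, ha, x, hx, fun P' hP' => ?_⟩
      by_cases e : P' = Q
      · subst e
        exact fun h' => h P (Finset.mem_erase.2 ⟨hne.symm, hP⟩) (hQP a x hx h')
      · exact h P' (Finset.mem_erase.2 ⟨e, hP'⟩)
    push Not at hinc
    obtain ⟨a, ha, x, hx, h⟩ := ih (S.erase P) (Finset.erase_ssubset hP)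
      (fun P' h => hS P' (Finset.mem_of_mem_erase h))
      (fun P' h => hrel P' (Finset.mem_of_mem_erase h))
    by_cases hxP : MonomialMem P a x
    -- Here x avoids every prime except P, and y lies in every prime except P. The powers make the
    -- degrees equal, and x^b + y^a avoids all of them.
    · obtain ⟨b, hb, y, hy, hyP, hyS⟩ :=
        exists_monomialMem_of_forall P (hrel P hP) (S.erase P) hinc
      have hxb : x ^ b ∈ I ^ (a * b) := by rw [pow_mul]; exact Ideal.pow_mem_pow hx b
      have hya : y ^ a ∈ I ^ (a * b) := by
        rw [mul_comm, pow_mul]; exact Ideal.pow_mem_pow hy a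
      have ex : reesMonomial (a * b) (x ^ b) hxb = reesMonomial a x hx ^ b :=
        (reesMonomial_pow hx b).symm
      have ey : reesMonomial (a * b) (y ^ a) hya = reesMonomial b y hy ^ a :=
        Subtype.ext (by
          rw [reesMonomial_pow]
          simp only [reesMonomial]
          rw [mul_comm])
      refine ⟨a * b, Nat.mul_pos ha hb, x ^ b + y ^ a, add_mem hxb hya, fun Q hQ hmem => ?_⟩
      rw [monomialMem_iff (add_mem hxb hya), ← reesMonomial_add hxb hya, ex, ey] at hmem
      by_cases e : Q = P
      · subst e
        rw [monomialMem_iff hx] at hxP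
        rw [monomialMem_iff hy] at hyP
        rw [Ideal.add_mem_iff_right _ (Ideal.pow_mem_of_mem _ hxP b hb)] at hmem
        exact hyP (this.mem_of_pow_mem _ hmem)
      · have hQ' := Finset.mem_erase.2 ⟨e, hQ⟩
        have hQp := hS Q hQ
        have h1 := hyS Q hQ'
        have h2 := h Q hQ'
        rw [monomialMem_iff hy] at h1
        rw [monomialMem_iff hx] at h2
        rw [Ideal.add_mem_iff_left _ (Ideal.pow_mem_of_mem _ h1 a ha)] at hmem
        exact h2 (hQp.mem_of_pow_mem _ hmem)
    · refine ⟨a, ha, x, hx, fun P' hP' => ?_⟩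
      by_cases e : P' = P
      · rwa [e]
      · exact h P' (Finset.mem_erase.2 ⟨e, hP'⟩)

/-- The Rees module of `W`, inside the Rees module of `V`. -/
noncomputable def reesSubmodule {M : Type v} [AddCommGroup M] [Module A M]
    (V W : I.Filtration M) : Submodule (reesAlgebra I) (ReesModule V) :=
  Submodule.comap (Submodule.subtype V.submodule) W.submodule

end HomogeneousPrimeAvoidance

/-! ### Existence of filter-regular elements. -/

section FilterRegular

open Polynomial

variable {A : Type u} [CommRing A] [IsNoetherianRing A] {I : Ideal A} {M : Type v}
  [AddCommGroup M] [Module A M] [Module.Finite A M]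

/-- A finitely generated graded module over the Rees algebra has a homogeneous filter-regular
element of positive degree. -/
theorem exists_filterRegular (V W : I.Filtration M)
    (hV : V ≤ I.stableFiltration ⊤) :
    ∃ a ≥ 1, ∃ x ∈ I ^ a, ∃ N, ∀ n ≥ N, ∀ w ∈ V.N n, x • w ∈ W.N (n + a) → w ∈ W.N n := by
  classical
  let E := ReesModule V ⧸ reesSubmodule V W
  have hVfg : V.submodule.FG :=
    (Ideal.Filtration.submodule_fg_iff_stable V fun i => IsNoetherian.noetherian _).2
      (le_stableFiltration_stable hV)
  have : Module.Finite (reesAlgebra I) (ReesModule V) := Module.Finite.of_fg hVfg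
  have hfin := associatedPrimes.finite (reesAlgebra I) E
  -- Avoid exactly the associated primes of E that miss some element of degree one.
  obtain ⟨a, ha, x, hx, hxS⟩ := exists_forall_not_monomialMem
    (hfin.toFinset.filter fun P => ∃ c ∈ I, ¬ MonomialMem P 1 c)
    (fun P hP => by
      rw [Finset.mem_filter, Set.Finite.mem_toFinset] at hP
      exact IsAssociatedPrime.isPrime hP.1)
    (fun P hP => (Finset.mem_filter.1 hP).2)
  let K : Submodule (reesAlgebra I) E := LinearMap.ker (LinearMap.lsmul _ E (reesMonomial a x hx))
  let J : Ideal (reesAlgebra I) := Ideal.span {r | ∃ c, ∃ hc : c ∈ I ^ 1, r = reesMonomial 1 c hc}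
  -- A minimal prime over the annihilator of K is associated to E and contains x tᵃ; by the choice
  -- of x it contains all elements of degree one. So a power of J kills the kernel K.
  have hJ : J ≤ (Module.annihilator (reesAlgebra I) K).radical := by
    rw [← Ideal.sInf_minimalPrimes, Ideal.span_le]
    rintro _ ⟨c, hc, rfl⟩
    simp only [SetLike.mem_coe, Ideal.mem_sInf]
    intro P hP
    have hPK := Module.associatedPrimes.minimalPrimes_annihilator_subset_associatedPrimes _ _ hP
    have hPE := associatedPrimes.subset_of_injective K.injective_subtype hPK
    have hxP : reesMonomial a x hx ∈ P := by
      refine hP.1.2 ?_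
      rw [Module.mem_annihilator]
      exact fun k => Subtype.ext k.2
    by_contra hcP
    refine hxS P ?_ ((monomialMem_iff hx).2 hxP)
    rw [Finset.mem_filter, Set.Finite.mem_toFinset]
    exact ⟨hPE, c, by simpa using hc, fun h => hcP ((monomialMem_iff hc).1 h)⟩
  obtain ⟨k, hk⟩ := Ideal.exists_pow_le_of_le_radical_of_fg hJ (IsNoetherian.noetherian J)
  have hmon : ∀ (j : ℕ) (c : A) (hc : c ∈ I ^ j), reesMonomial j c hc ∈ J ^ j := by
    intro j
    induction j with
    | zero => simp
    | succ j ih =>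
      intro c hc
      have hc' := hc
      rw [pow_succ] at hc'
      rw [← monomialMem_iff hc]
      refine Submodule.mul_induction_on hc' (fun d hd e he => ?_) (fun d e hd he => ?_)
      · have he1 : e ∈ I ^ 1 := by rwa [pow_one]
        refine ⟨reesMonomial j d hd * reesMonomial 1 e he1, ?_, monomial_mul_monomial _ _ _ _⟩
        rw [pow_succ]
        exact Ideal.mul_mem_mul (ih d hd) (Ideal.subset_span ⟨e, he1, rfl⟩)
      · obtain ⟨r, hr, er⟩ := hd
        obtain ⟨s, hs, es⟩ := he
        refine ⟨r + s, add_mem hr hs, ?_⟩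
        rw [map_add, ← er, ← es]
        rfl
  have hkill : ∀ n, ∀ w ∈ (kernelFiltration V W x a).N n, ∀ c ∈ I ^ k, c • w ∈ W.N (n + k) := by
    rintro n w ⟨hw, hxw⟩ c hc
    have hmem : PolynomialModule.single A n w ∈ V.submodule := by
      rw [← Ideal.Filtration.submodule_span_single]
      exact Submodule.subset_span (Set.mem_iUnion.2 ⟨n, w, hw, rfl⟩)
    obtain ⟨g, hg⟩ : ∃ g : ReesModule V, g.1 = PolynomialModule.single A n w :=
      ⟨⟨_, hmem⟩, rfl⟩
    have hcoeff : ∀ (j : ℕ) (d : A) (hd : d ∈ I ^ j),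
        (reesMonomial j d hd • g : ReesModule V).1 =
          PolynomialModule.single A (j + n) (d • w) :=
      fun j d hd => (congrArg (monomial j d • ·) hg).trans
        (PolynomialModule.monomial_smul_single _ _ _ _)
    let e : E := Submodule.Quotient.mk g
    have he : e ∈ K := by
      rw [LinearMap.mem_ker, LinearMap.lsmul_apply]
      change Submodule.Quotient.mk _ = _
      rw [Submodule.Quotient.mk_eq_zero]
      change (reesMonomial a x hx • g : ReesModule V).1 ∈ W.submodule
      rw [hcoeff, ← Ideal.Filtration.submodule_span_single]
      refine Submodule.subset_span (Set.mem_iUnion.2 ⟨a + n, x • w, ?_, rfl⟩)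
      rw [add_comm]
      exact hxw
    have h0 := Module.mem_annihilator.1 (hk (hmon k c hc)) ⟨e, he⟩
    have h2 : (reesMonomial k c hc • g : ReesModule V).1 ∈ W.submodule :=
      (Submodule.Quotient.mk_eq_zero (reesSubmodule V W)
        (x := (reesMonomial k c hc • g : ReesModule V))).1 (congrArg Subtype.val h0)
    rw [hcoeff] at h2
    have h3 := h2 (k + n)
    rwa [PolynomialModule.coeff_single, Finsupp.single_eq_same, add_comm] at h3
  obtain ⟨N, hN⟩ := (le_stableFiltration_stable
    ((kernelFiltration_le V W x a).trans hV)).exists_pow_smul_eq_of_ge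
  refine ⟨a, ha, x, hx, N + k, fun n hn w hw hxw => ?_⟩
  have hwK : w ∈ (kernelFiltration V W x a).N n := ⟨hw, hxw⟩
  -- By stability the kernel in degree n is I^k times the kernel in degree n - k, and I^k carries
  -- the latter into W.
  have hle : (kernelFiltration V W x a).N n ≤ W.N n := by
    have e : n - N = k + (n - k - N) := by omega
    have h1 : (kernelFiltration V W x a).N n = I ^ k • (kernelFiltration V W x a).N (n - k) := by
      rw [hN n (by omega), hN (n - k) (by omega), e, pow_add, Submodule.mul_smul]
    rw [h1, Submodule.smul_le]
    intro c hc v hv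
    have := hkill _ v hv c hc
    rwa [Nat.sub_add_cancel (by omega)] at this
  exact hle hwK

end FilterRegular

theorem withBot_eq_zero_of_add_two {d : WithBot ℕ∞} (h : d + ((2 : ℕ) : WithBot ℕ∞) = 2) :
    d = 0 := by
  induction d using WithBot.recBotCoe with
  | bot =>
    rw [WithBot.bot_add] at h
    exact absurd h.symm (WithBot.coe_ne_bot (a := (2 : ℕ∞)))
  | coe e =>
    have h' : e + 2 = 2 := WithBot.coe_injective h
    induction e using ENat.recTopCoe with
    | top => exact absurd h' (by rw [top_add]; exact ENat.top_ne_natCast 2)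
    | coe n =>
      have : n + 2 = 2 := by exact_mod_cast h'
      obtain rfl : n = 0 := by omega
      rfl

/-! ### Regular pairs and their transfer to other parameters. -/

section RegularPair

variable {A : Type u} [CommRing A]

/-- `x, y` is a weakly regular sequence on `M`. -/
structure IsRegularPair (x y : A) (M : Type v) [AddCommGroup M] [Module A M] : Prop where
  left : ∀ m : M, x • m = 0 → m = 0
  right : ∀ m n : M, y • m = x • n → ∃ t, m = x • t

variable {M : Type v} [AddCommGroup M] [Module A M]

namespace IsRegularPair

variable {x y : A}

theorem cancel (h : IsRegularPair x y M) {m n : M} (e : x • m = x • n) : m = n := by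
  rw [← sub_eq_zero]
  exact h.left _ (by rw [smul_sub, e, sub_self])

theorem pow_right (h : IsRegularPair x y M) (k : ℕ) : IsRegularPair x (y ^ k) M := by
  refine ⟨h.left, ?_⟩
  induction k with
  | zero => exact fun m n e => ⟨n, by simpa using e⟩
  | succ k ih =>
    intro m n e
    rw [pow_succ, mul_smul] at e
    obtain ⟨t, ht⟩ := ih _ _ e
    exact h.right _ _ ht

theorem pow_left (h : IsRegularPair x y M) (k : ℕ) : IsRegularPair (x ^ k) y M := by
  induction k with
  | zero => exact ⟨fun m e => by simpa using e, fun m n _ => ⟨m, by simp⟩⟩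
  | succ k ih =>
    refine ⟨fun m e => ih.left _ (h.left _ (by rwa [pow_succ', mul_smul] at e)), fun m n e => ?_⟩
    rw [pow_succ', mul_smul] at e
    obtain ⟨t, rfl⟩ := h.right _ _ e
    rw [smul_comm] at e
    obtain ⟨s, rfl⟩ := ih.right _ _ (h.cancel e)
    exact ⟨s, by rw [pow_succ', mul_smul]⟩

/-- If powers of a regular sequence `u, v` lie in `(x, y) + ann M`, then `x, y` is a regular
sequence. -/
theorem of_mem_sup_annihilator [IsLocalRing A] [IsNoetherianRing A] [Module.Finite A M]
    {u v : A} (h : IsRegularPair u v M) (hy : y ∈ maximalIdeal A)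
    (hu : u ∈ Ideal.span {x, y} ⊔ Module.annihilator A M)
    (hv : v ∈ Ideal.span {x, y} ⊔ Module.annihilator A M) : IsRegularPair x y M := by
  have expand : ∀ c ∈ Ideal.span {x, y} ⊔ Module.annihilator A M,
      ∃ a b : A, ∀ m : M, c • m = x • a • m + y • b • m := by
    intro c hc
    obtain ⟨d, hd, e, he, rfl⟩ := Submodule.mem_sup.1 hc
    obtain ⟨a, b, rfl⟩ := Ideal.mem_span_pair.1 hd
    refine ⟨a, b, fun m => ?_⟩
    rw [add_smul, Module.mem_annihilator.1 he m, add_zero, add_smul]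
    simp only [smul_smul, mul_comm]
  obtain ⟨a, b, hab⟩ := expand u hu
  obtain ⟨a', b', hab'⟩ := expand v hv
  -- Nakayama on K = (0 :_M x). For m ∈ K, um = ybm and vm = yb'm, so v(bm) = u(b'm) and bm = ut
  -- with t ∈ K; cancelling u in um = uyt gives m = yt ∈ 𝔪K.
  have hx : ∀ m : M, x • m = 0 → m = 0 := by
    let K : Submodule A M := LinearMap.ker (LinearMap.lsmul A M x)
    have hK : ∀ m, m ∈ K ↔ x • m = 0 := fun m => LinearMap.mem_ker
    have hbot : K = ⊥ := by
      refine Submodule.eq_bot_of_le_smul_of_le_jacobson_bot (maximalIdeal A) K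
        (IsNoetherian.noetherian K) ?_ (IsLocalRing.maximalIdeal_le_jacobson _)
      intro m hm
      have hxm : x • m = 0 := (hK m).1 hm
      have e1 : ∀ m : M, x • m = 0 → u • m = y • b • m := fun m hm => by
        rw [hab, smul_comm x a m, hm, smul_zero, zero_add]
      have e2 : ∀ m : M, x • m = 0 → v • m = y • b' • m := fun m hm => by
        rw [hab', smul_comm x a' m, hm, smul_zero, zero_add]
      have e3 : v • b • m = u • b' • m := by
        rw [e1 _ (by rw [smul_comm, hxm, smul_zero]), e2 _ (by rw [smul_comm, hxm, smul_zero]),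
          smul_comm b b']
      obtain ⟨t, ht⟩ := h.right _ _ e3
      have hxt : x • t = 0 := by
        refine h.left _ ?_
        rw [smul_comm, ← ht, smul_comm, hxm, smul_zero]
      have e4 : u • m = u • y • t := by
        rw [e1 m hxm, ht, smul_comm]
      rw [h.cancel e4]
      exact Submodule.smul_mem_smul hy ((hK t).2 hxt)
    intro m hm
    have : m ∈ K := (hK m).2 hm
    rwa [hbot, Submodule.mem_bot] at this
  refine ⟨hx, fun m n e => ?_⟩
  -- Both um and vm are multiples of x. Comparing v(um) with u(vm) and cancelling x gives am + bn =
  -- ut, hence um = uxt and m = xt.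
  have hum : u • m = x • (a • m + b • n) := by
    rw [hab, smul_comm y, e, smul_add, smul_comm b]
  have hvm : v • m = x • (a' • m + b' • n) := by
    rw [hab', smul_comm y, e, smul_add, smul_comm b']
  have e1 : v • (a • m + b • n) = u • (a' • m + b' • n) := by
    rw [← sub_eq_zero]
    refine hx _ ?_
    rw [smul_sub, smul_comm x v, smul_comm x u, ← hum, ← hvm, smul_comm, sub_self]
  obtain ⟨t, ht⟩ := h.right _ _ e1
  refine ⟨t, h.cancel ?_⟩
  rw [hum, ht, smul_comm]

end IsRegularPair

/-- The support of M/JM is V(J + ann M), so a prime containing J + ann M contains the annihilator of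
M/JM, hence c^k and c. -/
theorem mem_radical_of_pow_smul_top_le [Module.Finite A M] {J : Ideal A}
    {c : A} {k : ℕ} (h : ∀ m : M, c ^ k • m ∈ J • (⊤ : Submodule A M)) :
    c ∈ (J ⊔ Module.annihilator A M).radical := by
  rw [Ideal.radical_eq_sInf, Ideal.mem_sInf]
  rintro p ⟨hp, hprime⟩
  have hs : (⟨p, hprime⟩ : PrimeSpectrum A) ∈
      Module.support A (M ⧸ (J • (⊤ : Submodule A M))) := by
    rw [Module.support_quotient]
    refine ⟨?_, le_sup_left.trans hp⟩
    rw [Module.mem_support_iff_of_finite]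
    exact le_sup_right.trans hp
  rw [Module.mem_support_iff_of_finite] at hs
  refine hprime.mem_of_pow_mem k (hs ?_)
  rw [Module.mem_annihilator]
  intro q
  obtain ⟨m, rfl⟩ := Submodule.mkQ_surjective _ q
  rw [← map_smul, Submodule.mkQ_apply, Submodule.Quotient.mk_eq_zero]
  exact h m

end RegularPair

/-! ### A regular system of parameters on M. -/

section DimensionTwo

variable {A : Type u} [CommRing A] [IsLocalRing A] [IsNoetherianRing A]
  {M : Type v} [AddCommGroup M] [Module A M] [Module.Finite A M]

/-- A Cohen-Macaulay module of dimension two has a regular sequence of length two that is a system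
of parameters. -/
theorem exists_regularPair (hdim : Module.supportDim A M = 2)
    (hCM : IsCohenMacaulay A (maximalIdeal A) M) :
    ∃ u ∈ maximalIdeal A, ∃ v ∈ maximalIdeal A, IsRegularPair u v M ∧
      ∃ s : ℕ, maximalIdeal A ^ s • (⊤ : Submodule A M) ≤
        Ideal.span {u, v} • (⊤ : Submodule A M) := by
  have hnt : Nontrivial M := by
    rw [← Module.supportDim_ne_bot_iff_nontrivial A, hdim]
    exact WithBot.coe_ne_bot (a := (2 : ℕ∞))
  have hd : depth A (maximalIdeal A) M = 2 := by
    have := hCM hnt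
    rw [hdim] at this
    exact WithBot.coe_injective this
  obtain ⟨rs, ⟨hrs, hreg⟩, hlen⟩ : ∃ rs : List A, ((∀ r ∈ rs, r ∈ maximalIdeal A) ∧
      RingTheory.Sequence.IsRegular M rs) ∧ 2 ≤ rs.length := by
    by_contra hcon
    push Not at hcon
    have : depth A (maximalIdeal A) M ≤ 1 := by
      refine iSup₂_le fun rs h => ?_
      have := hcon rs h
      exact_mod_cast Nat.lt_succ_iff.1 this
    rw [hd] at this
    exact absurd this (by decide)
  match rs, hlen with
  | u :: v :: rs, _ =>
    rw [RingTheory.Sequence.isRegular_cons_iff, RingTheory.Sequence.isRegular_cons_iff] at hreg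
    obtain ⟨hu, hv, -⟩ := hreg
    have hum : u ∈ maximalIdeal A := hrs u (by simp)
    have hvm : v ∈ maximalIdeal A := hrs v (by simp)
    refine ⟨u, hum, v, hvm, ⟨?_, ?_⟩, ?_⟩
    · exact fun m hm => hu.right_eq_zero_of_smul hm
    · intro m n e
      have := mem_of_isSMulRegular_quotient_of_smul_mem hv
        (e ▸ Submodule.smul_mem_pointwise_smul n u ⊤ trivial)
      obtain ⟨t, -, rfl⟩ := this
      exact ⟨t, rfl⟩
    · have hw : RingTheory.Sequence.IsWeaklyRegular M [u, v] :=
        .cons hu (.cons hv (.nil _ _))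
      have hr := RingTheory.Sequence.IsRegular.of_isWeaklyRegular_of_mem_maximalIdeal M
        (by
          intro r hr
          refine hrs r ?_
          simp only [List.mem_cons] at hr ⊢
          tauto) hw
      -- M/(u, v)M has dimension zero, so its support is {𝔪} and a power of 𝔪 kills it.
      have h2 := Module.supportDim_add_length_eq_supportDim_of_isRegular [u, v] hr
      have hJ : (Ideal.ofList [u, v]) = Ideal.span {u, v} := by
        simp [Ideal.span_insert]
      rw [hdim, hJ] at h2
      have h0 : Module.supportDim A (M ⧸ Ideal.span {u, v} • (⊤ : Submodule A M)) = 0 := by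
        exact withBot_eq_zero_of_add_two h2
      have hs := support_of_supportDim_eq_zero A _ h0
      have hle : maximalIdeal A ≤
          (Module.annihilator A (M ⧸ Ideal.span {u, v} • (⊤ : Submodule A M))).radical := by
        rw [Ideal.radical_eq_sInf]
        refine le_sInf ?_
        rintro p ⟨hp, hprime⟩
        have hmem : (⟨p, hprime⟩ : PrimeSpectrum A) ∈
            Module.support A (M ⧸ Ideal.span {u, v} • (⊤ : Submodule A M)) :=
          Module.mem_support_iff_of_finite.2 hp
        rw [hs] at hmem
        exact hmem
      obtain ⟨s, hs⟩ := Ideal.exists_pow_le_of_le_radical_of_fg hle (IsNoetherian.noetherian _)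
      refine ⟨s, ?_⟩
      rw [Submodule.smul_le]
      intro r hr m _
      have := Module.mem_annihilator.1 (hs hr) (Submodule.Quotient.mk m)
      rwa [← Submodule.Quotient.mk_smul, Submodule.Quotient.mk_eq_zero] at this

end DimensionTwo

/-! ### Finite length from a power of the maximal ideal. -/

section FiniteLength

variable {A : Type u} [CommRing A] [IsLocalRing A] [IsNoetherianRing A]
  {M : Type v} [AddCommGroup M] [Module A M]

/-- A Noetherian local ring with nilpotent maximal ideal is Artinian. The exponent s + 1 keeps the
quotient nonzero, hence local. -/
theorem isArtinianRing_quotient_maximalIdeal_pow (s : ℕ) :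
    IsArtinianRing (A ⧸ maximalIdeal A ^ (s + 1)) := by
  have hle : maximalIdeal A ^ (s + 1) ≤ maximalIdeal A := Ideal.pow_le_self (by omega)
  have hnt : Nontrivial (A ⧸ maximalIdeal A ^ (s + 1)) :=
    Ideal.Quotient.nontrivial_iff.2
      (ne_top_of_le_ne_top (maximalIdeal.isMaximal A).ne_top hle)
  have hloc : IsLocalRing (A ⧸ maximalIdeal A ^ (s + 1)) :=
    IsLocalRing.of_surjective' (Ideal.Quotient.mk _) Ideal.Quotient.mk_surjective
  rw [isArtinianRing_iff_isNilpotent_maximalIdeal]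
  refine ⟨s + 1, ?_⟩
  have : maximalIdeal (A ⧸ maximalIdeal A ^ (s + 1)) ≤
      (maximalIdeal A).map (Ideal.Quotient.mk (maximalIdeal A ^ (s + 1))) := by
    intro z hz
    obtain ⟨r, rfl⟩ := Ideal.Quotient.mk_surjective z
    refine Ideal.mem_map_of_mem _ ?_
    rw [mem_maximalIdeal, mem_nonunits_iff] at hz ⊢
    exact fun h => hz (h.map _)
  rw [Ideal.zero_eq_bot, eq_bot_iff]
  refine (Ideal.pow_right_mono this _).trans ?_
  rw [← Ideal.map_pow, Ideal.map_quotient_self]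

theorem relLength_top_ne_top [Module.Finite A M] {W : Submodule A M} {s : ℕ}
    (h : maximalIdeal A ^ s • (⊤ : Submodule A M) ≤ W) : relLength ⊤ W ≠ ⊤ := by
  rw [relLength_top]
  have htor : Module.IsTorsionBySet A (M ⧸ W) (maximalIdeal A ^ (s + 1) : Ideal A) := by
    rintro q ⟨r, hr⟩
    obtain ⟨m, rfl⟩ := Submodule.mkQ_surjective _ q
    change r • W.mkQ m = 0
    rw [← map_smul, Submodule.mkQ_apply, Submodule.Quotient.mk_eq_zero]
    exact h (Submodule.smul_mem_smul (Ideal.pow_le_pow_right (Nat.le_succ s) hr) trivial)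
  let _ := htor.module
  have : IsScalarTower A (A ⧸ maximalIdeal A ^ (s + 1)) (M ⧸ W) := htor.isScalarTower
  have := isArtinianRing_quotient_maximalIdeal_pow (A := A) s
  have : Module.Finite (A ⧸ maximalIdeal A ^ (s + 1)) (M ⧸ W) :=
    Module.Finite.of_restrictScalars_finite A _ _
  rw [Module.length_eq_of_surjective (R := A ⧸ maximalIdeal A ^ (s + 1)) (S := A)
    (M := M ⧸ W) Ideal.Quotient.mk_surjective]
  exact Module.length_ne_top

end FiniteLength

/-! ### Lengths modulo multiples and powers. -/

section Multiples

variable {A : Type u} [CommRing A] {M : Type v} [AddCommGroup M] [Module A M]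

/-- The submodule `x V`. -/
abbrev mulSub (x : A) (V : Submodule A M) : Submodule A M := V.map (LinearMap.lsmul A M x)

theorem mulSub_mul (x y : A) (V : Submodule A M) : mulSub (x * y) V = mulSub x (mulSub y V) := by
  ext m
  simp [mul_smul]

theorem mulSub_one (V : Submodule A M) : mulSub (1 : A) V = V := by
  ext m
  simp

theorem mulSub_sup (x : A) (V W : Submodule A M) :
    mulSub x (V ⊔ W) = mulSub x V ⊔ mulSub x W := Submodule.map_sup _ _ _

theorem mulSub_mono {x : A} {V W : Submodule A M} (h : V ≤ W) : mulSub x V ≤ mulSub x W :=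
  Submodule.map_mono h

theorem span_pair_smul_top (x y : A) :
    Ideal.span {x, y} • (⊤ : Submodule A M) = mulSub x ⊤ ⊔ mulSub y ⊤ := by
  rw [Ideal.span_insert, Submodule.sup_smul, Submodule.ideal_span_singleton_smul,
    Submodule.ideal_span_singleton_smul]
  rfl

theorem smul_mulSub (J : Ideal A) (x : A) (V : Submodule A M) :
    J • mulSub x V = mulSub x (J • V) := (Submodule.map_smul'' J V _).symm

theorem mulSub_le_pow_smul {I : Ideal A} {x : A} {a : ℕ} (hx : x ∈ I ^ a) (n : ℕ) :
    mulSub x (I ^ n • (⊤ : Submodule A M)) ≤ I ^ (n + a) • (⊤ : Submodule A M) := by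
  rw [add_comm, pow_add, Submodule.mul_smul]
  rintro _ ⟨w, hw, rfl⟩
  exact Submodule.smul_mem_smul hx hw

/-- In the chain M ⊇ aM + W ⊇ abM + W, multiplication by a maps M/(bM + W) onto the lower quotient.
-/
theorem relLength_top_mul_sup_le (a b : A) (W : Submodule A M) :
    relLength ⊤ (mulSub (a * b) ⊤ ⊔ W) ≤
      relLength ⊤ (mulSub a ⊤ ⊔ W) + relLength ⊤ (mulSub b ⊤ ⊔ W) := by
  have hab : mulSub (a * b) (⊤ : Submodule A M) ≤ mulSub a ⊤ := by
    rw [mulSub_mul]; exact mulSub_mono le_top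
  rw [relLength_add (V := mulSub a ⊤ ⊔ W) le_top (sup_le_sup_right hab W)]
  gcongr
  have e : mulSub a ⊤ ⊔ W = mulSub a ⊤ ⊔ (mulSub (a * b) ⊤ ⊔ W) := by
    rw [← sup_assoc, sup_eq_left.2 hab]
  rw [e, ← relLength_comap]
  refine relLength_mono le_rfl (sup_le ?_ ?_)
  · rw [← Submodule.map_le_iff_le_comap]
    change mulSub a (mulSub b ⊤) ≤ _
    rw [← mulSub_mul]
    exact le_sup_left
  · intro w hw
    exact Submodule.mem_sup_right (W.smul_mem a hw)

theorem relLength_top_pow_sup_le (a : A) (W : Submodule A M) (n : ℕ) :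
    relLength ⊤ (mulSub (a ^ n) ⊤ ⊔ W) ≤ n * relLength ⊤ (mulSub a ⊤ ⊔ W) := by
  induction n with
  | zero =>
    rw [pow_zero, mulSub_one, top_sup_eq, relLength_eq_zero_iff.2 le_rfl]
    exact zero_le
  | succ n ih =>
    rw [pow_succ]
    refine (relLength_top_mul_sup_le _ _ W).trans ?_
    push_cast
    rw [add_mul, one_mul]
    gcongr

theorem relLength_top_pow_pow_le (a b : A) (n : ℕ) :
    relLength (⊤ : Submodule A M) (mulSub (a ^ n) ⊤ ⊔ mulSub (b ^ n) ⊤) ≤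
      n ^ 2 * relLength (⊤ : Submodule A M) (mulSub a ⊤ ⊔ mulSub b ⊤) := by
  refine (relLength_top_pow_sup_le _ _ _).trans ?_
  rw [sup_comm, pow_two, mul_assoc]
  gcongr
  refine (relLength_top_pow_sup_le _ _ _).trans ?_
  rw [sup_comm]

end Multiples

/-! ### The Hilbert function of the I-adic filtration. -/

section AdicHilbert

variable {A : Type u} [CommRing A] {I : Ideal A} {M : Type v} [AddCommGroup M] [Module A M]

/-- The filtration `(F_{n+1})`. -/
def shiftFiltration (F : I.Filtration M) : I.Filtration M where
  N n := F.N (n + 1)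
  mono n := F.mono (n + 1)
  smul_le n := F.smul_le (n + 1)

theorem shiftFiltration_le (F : I.Filtration M) : shiftFiltration F ≤ F := fun n => F.mono n

/-- The colength of `F_n`. -/
noncomputable def colength (F : I.Filtration M) (n : ℕ) : ℤ :=
  ((relLength ⊤ (F.N n)).toNat : ℤ)

theorem pairHilbert_shiftFiltration (F : I.Filtration M) (n : ℕ) :
    pairHilbert F (shiftFiltration F) n = hilbertFunction F n := rfl

theorem colength_succ {F : I.Filtration M} (hF : ∀ n, relLength ⊤ (F.N n) ≠ ⊤) (n : ℕ) :
    colength F (n + 1) = colength F n + hilbertFunction F n := by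
  have key := relLength_add (U := ⊤) (V := F.N n) (W := F.N (n + 1)) le_top (F.mono n)
  have h : relLength (F.N n) (F.N (n + 1)) ≠ ⊤ :=
    ne_top_of_le_ne_top (hF (n + 1)) (relLength_mono le_top le_rfl)
  have := congrArg ENat.toNat key
  rw [ENat.toNat_add (hF n) h] at this
  change ((_ : ℕ) : ℤ) = _ + ((_ : ℕ) : ℤ)
  rw [this]
  push_cast
  rfl

theorem pow_mul_smul_le {J : Ideal A} {k : ℕ} (h : J ^ k • (⊤ : Submodule A M) ≤ I • ⊤) (n : ℕ) :
    J ^ (k * n) • (⊤ : Submodule A M) ≤ I ^ n • ⊤ := by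
  induction n with
  | zero => simp
  | succ n ih =>
    rw [Nat.mul_succ, pow_add, Submodule.mul_smul, pow_succ, Submodule.mul_smul]
    refine (smul_mono_right _ h).trans ?_
    rw [← Submodule.mul_smul, ← Submodule.mul_smul, mul_comm, mul_comm _ I, Submodule.mul_smul,
      Submodule.mul_smul]
    exact smul_mono_right _ ih

variable [IsLocalRing A] [IsNoetherianRing A] [Module.Finite A M]

theorem relLength_adic_ne_top (hI : IsIdealOfDefinition I M) (n : ℕ) :
    relLength ⊤ ((I.stableFiltration (⊤ : Submodule A M)).N n) ≠ ⊤ := by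
  obtain ⟨-, k, hk⟩ := hI
  exact relLength_top_ne_top (pow_mul_smul_le hk n)

/-- Since 𝔪^k M ⊆ IM, both u^(kn)M and v^(kn)M lie in IⁿM, so λ(M/IⁿM) ≤ n² λ(M/(u^k, v^k)M). -/
theorem colength_adic_le_sq (hI : IsIdealOfDefinition I M) {u v : A}
    (hu : u ∈ maximalIdeal A) (hv : v ∈ maximalIdeal A) {s : ℕ}
    (huv : maximalIdeal A ^ s • (⊤ : Submodule A M) ≤ Ideal.span {u, v} • ⊤) :
    ∃ c : ℤ, ∀ n : ℕ, colength (I.stableFiltration (⊤ : Submodule A M)) n ≤ c * (n : ℤ) ^ 2 := by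
  obtain ⟨hIm, k, hk⟩ := id hI
  have hpow : ∀ w ∈ maximalIdeal A, ∀ n, mulSub ((w ^ k) ^ n) (⊤ : Submodule A M) ≤ I ^ n • ⊤ := by
    rintro w hw n _ ⟨m, -, rfl⟩
    rw [← pow_mul]
    exact pow_mul_smul_le hk n (Submodule.smul_mem_smul (Ideal.pow_mem_pow hw _) trivial)
  have hL : relLength (⊤ : Submodule A M) (mulSub (u ^ k) ⊤ ⊔ mulSub (v ^ k) ⊤) ≠ ⊤ := by
    refine ne_top_of_le_ne_top ?_ (relLength_top_pow_pow_le u v k)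
    rw [← span_pair_smul_top]
    exact WithTop.mul_ne_top (by exact_mod_cast ENat.natCast_ne_top (k ^ 2)) (relLength_top_ne_top huv)
  refine ⟨((relLength (⊤ : Submodule A M) (mulSub (u ^ k) ⊤ ⊔ mulSub (v ^ k) ⊤)).toNat : ℤ),
    fun n => ?_⟩
  have h1 : relLength ⊤ ((I.stableFiltration (⊤ : Submodule A M)).N n) ≤
      n ^ 2 * relLength (⊤ : Submodule A M) (mulSub (u ^ k) ⊤ ⊔ mulSub (v ^ k) ⊤) :=
    (relLength_mono le_rfl (sup_le (hpow u hu n) (hpow v hv n))).trans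
      (relLength_top_pow_pow_le _ _ n)
  have h2 := ENat.toNat_le_toNat h1
    (WithTop.mul_ne_top (by exact_mod_cast ENat.natCast_ne_top (n ^ 2)) hL)
  rw [ENat.toNat_mul] at h2
  have h3 : ((n : ℕ∞) ^ 2).toNat = n ^ 2 := by exact_mod_cast ENat.toNat_natCast (n ^ 2)
  rw [h3] at h2
  rw [colength, mul_comm]
  exact_mod_cast h2

/-- The Hilbert function of an ideal of definition of a Cohen-Macaulay module of dimension two is
eventually polynomial of degree at most one. -/
theorem eventuallyPoly_hilbertFunction_adic (hdim : Module.supportDim A M = 2)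
    (hCM : IsCohenMacaulay A (maximalIdeal A) M) (hI : IsIdealOfDefinition I M) :
    EventuallyPoly 2
      (fun n => (hilbertFunction (I.stableFiltration (⊤ : Submodule A M)) n : ℤ)) := by
  set F := I.stableFiltration (⊤ : Submodule A M) with hF
  have hfin := relLength_adic_ne_top (M := M) hI
  obtain ⟨S, hS⟩ := (IsNoetherian.noetherian I : I.FG)
  have hpoly : EventuallyPoly S.toList.length (pairHilbert F (shiftFiltration F)) := by
    refine eventuallyPoly_pairHilbert S.toList ⊥ ?_ F (shiftFiltration F) (shiftFiltration_le F)
      le_rfl (fun n => ne_top_of_le_ne_top (hfin (n + 1)) (relLength_mono le_top le_rfl)) ?_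
    · rw [bot_sup_eq, ← hS]
      congr 1
      ext c
      simp
    · intro c hc n w _
      rw [Ideal.mem_bot.1 hc, zero_smul]
      exact zero_mem _
  have hdiff : diff (colength F) = pairHilbert F (shiftFiltration F) := by
    ext n
    rw [diff, colength_succ hfin, pairHilbert_shiftFiltration]
    ring
  obtain ⟨u, hu, v, hv, -, s, hs⟩ := exists_regularPair hdim hCM
  obtain ⟨c, hc⟩ := colength_adic_le_sq hI hu hv hs
  -- The induction on generators bounds the degree only by their number; the quadratic bound brings
  -- it down to two.
  have h3 : EventuallyPoly 3 (colength F) := by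
    refine EventuallyPoly.of_le_sq (k := S.toList.length + 1) ?_ (fun n => Int.natCast_nonneg _) hc
    rw [EventuallyPoly.succ_iff, hdiff]
    exact hpoly
  rw [EventuallyPoly.succ_iff, hdiff] at h3
  exact h3

end AdicHilbert

/-! ### Homogeneous parameters of the associated graded module. -/

section Parameters

variable {A : Type u} [CommRing A] [IsNoetherianRing A] {I : Ideal A}
  {M : Type v} [AddCommGroup M] [Module A M] [Module.Finite A M]

/-- Modulo a filter-regular element the Hilbert function in degree n + a becomes f(n + a) - f(n) for
large n, which lowers the degree by one. -/
theorem exists_eventuallyPoly_imageFiltration {V W : I.Filtration M} (hWV : W ≤ V)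
    (hV : V ≤ I.stableFiltration ⊤) (hfin : ∀ n, relLength (V.N n) (W.N n) ≠ ⊤) {k : ℕ}
    (hk : EventuallyPoly (k + 1) (pairHilbert V W)) :
    ∃ a ≥ 1, ∃ x ∈ I ^ a, (∃ N, ∀ n ≥ N, ∀ w ∈ V.N n, x • w ∈ W.N (n + a) → w ∈ W.N n) ∧
      EventuallyPoly k (pairHilbert V (imageFiltration V W x a)) := by
  obtain ⟨a, ha, x, hx, N, hN⟩ := exists_filterRegular V W hV
  refine ⟨a, ha, x, hx, ⟨N, hN⟩, ?_⟩
  rw [← EventuallyPoly.shift_iff a]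
  refine (hk.shift_sub a).congr (N := N) fun n hn => ?_
  have h := pairHilbert_add V W hWV hfin hx n
  have h0 : pairHilbert (kernelFiltration V W x a) W n = 0 := by
    have : relLength ((kernelFiltration V W x a).N n) (W.N n) = 0 :=
      relLength_eq_zero_iff.2 fun w hw => hN n hn w hw.1 hw.2
    rw [pairHilbert, this]
    rfl
  rw [h0] at h
  linarith

/-- Two homogeneous parameters of the associated graded module of `M`, the first of which is
filter-regular. -/
theorem exists_parameters [IsLocalRing A] (hdim : Module.supportDim A M = 2)
    (hCM : IsCohenMacaulay A (maximalIdeal A) M) (hI : IsIdealOfDefinition I M) :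
    ∃ a ≥ 1, ∃ b ≥ 1, ∃ x ∈ I ^ a, ∃ y ∈ I ^ b,
      (∃ N, ∀ n ≥ N, ∀ w ∈ I ^ n • (⊤ : Submodule A M),
        x • w ∈ I ^ (n + a + 1) • (⊤ : Submodule A M) → w ∈ I ^ (n + 1) • (⊤ : Submodule A M)) ∧
      ∃ N, ∀ n ≥ N, I ^ n • (⊤ : Submodule A M) ≤
        mulSub x (I ^ (n - a) • ⊤) ⊔ mulSub y (I ^ (n - b) • ⊤) := by
  set F := I.stableFiltration (⊤ : Submodule A M) with hF
  have hfin := relLength_adic_ne_top (M := M) hI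
  have hfin1 : ∀ n, relLength (F.N n) ((shiftFiltration F).N n) ≠ ⊤ :=
    fun n => ne_top_of_le_ne_top (hfin (n + 1)) (relLength_mono le_top le_rfl)
  obtain ⟨a, ha, x, hx, hxreg, h1⟩ := exists_eventuallyPoly_imageFiltration
    (shiftFiltration_le F) le_rfl hfin1 (eventuallyPoly_hilbertFunction_adic hdim hCM hI)
  have hfin2 : ∀ n, relLength (F.N n) ((imageFiltration F (shiftFiltration F) x a).N n) ≠ ⊤ :=
    fun n => ne_top_of_le_ne_top (hfin1 n) (relLength_mono le_rfl (le_imageFiltration _ _ x a n))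
  obtain ⟨b, hb, y, hy, -, N, hN⟩ := exists_eventuallyPoly_imageFiltration
    (imageFiltration_le (shiftFiltration_le F) hx) le_rfl hfin2 h1
  refine ⟨a, ha, b, hb, x, hx, y, hy, ?_, N, fun n hn => ?_⟩
  · obtain ⟨N', hN'⟩ := hxreg
    exact ⟨N', fun n hn w hw hxw => hN' n hn w hw hxw⟩
  · have h0 : (relLength (F.N n) ((imageFiltration F (imageFiltration F (shiftFiltration F) x a)
        y b).N n)).toNat = 0 := by
      have := hN n hn
      rw [Function.iterate_zero, id, pairHilbert] at this
      exact_mod_cast this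
    rw [ENat.toNat_eq_zero] at h0
    have h0' := h0.resolve_right
      (ne_top_of_le_ne_top (hfin2 n) (relLength_mono le_rfl (le_imageFiltration _ _ y b n)))
    rw [relLength_eq_zero_iff] at h0'
    -- After two reductions the Hilbert function is eventually zero: IⁿM ⊆ I^(n+1)M + xI^(n-a)M +
    -- yI^(n-b)M. Nakayama removes the first term.
    refine Submodule.le_of_le_smul_of_le_jacobson_bot (I := maximalIdeal A)
      (IsNoetherian.noetherian _) (maximalIdeal_le_jacobson _) ?_
    refine (show I ^ n • (⊤ : Submodule A M) ≤ (I ^ (n + 1) • ⊤ ⊔ mulSub x (I ^ (n - a) • ⊤)) ⊔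
      mulSub y (I ^ (n - b) • ⊤) from h0').trans ?_
    rw [sup_assoc, sup_comm]
    refine sup_le_sup_left ?_ _
    rw [pow_succ', Submodule.mul_smul]
    exact Submodule.smul_mono_left hI.1

end Parameters

/-! ### Passing to powers of the parameters. -/

section Iteration

variable {A : Type u} [CommRing A] {I : Ideal A} {M : Type v} [AddCommGroup M] [Module A M]

/-- A weighted reduction equation can be iterated. -/
theorem eventually_le_mulSub_pow {x y : A} {a b : ℕ} (hx : x ∈ I ^ a)
    (h : ∃ N, ∀ n ≥ N, I ^ n • (⊤ : Submodule A M) ≤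
        mulSub x (I ^ (n - a) • ⊤) ⊔ mulSub y (I ^ (n - b) • ⊤)) (i : ℕ) :
    ∃ N, ∀ n ≥ N, I ^ n • (⊤ : Submodule A M) ≤
        mulSub (x ^ i) (I ^ (n - i * a) • ⊤) ⊔ mulSub y (I ^ (n - b) • ⊤) := by
  induction i with
  | zero => exact ⟨0, fun n _ => by
    rw [pow_zero, mulSub_one, zero_mul, Nat.sub_zero]; exact le_sup_left⟩
  | succ i ih =>
    obtain ⟨N, hN⟩ := h
    obtain ⟨N', hN'⟩ := ih
    refine ⟨N + N' + i * a + b, fun n hn => ?_⟩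
    refine (hN' n (by omega)).trans (sup_le ?_ le_sup_right)
    -- Apply the relation to the factor behind x^i. The new term x^i y I^(n-ia-b)M lies in y
    -- I^(n-b)M; the threshold prevents truncation.
    refine (mulSub_mono (hN (n - i * a) (by omega))).trans ?_
    rw [mulSub_sup]
    refine sup_le_sup ?_ ?_
    · rw [pow_succ, mulSub_mul, add_mul, one_mul, Nat.sub_sub]
    · rw [← mulSub_mul, mul_comm, mulSub_mul]
      refine mulSub_mono ((mulSub_le_pow_smul (a := i * a) ?_ _).trans ?_)
      · rw [mul_comm, pow_mul]
        exact Ideal.pow_mem_pow hx i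
      · rw [show n - i * a - b + i * a = n - b by omega]

end Iteration

/-! ### The Koszul length count. -/

section Count

variable {A : Type u} [CommRing A] {M : Type v} [AddCommGroup M] [Module A M]

theorem relLength_top_prod (P : Submodule A M) :
    relLength ⊤ (P.prod P) = relLength ⊤ P + relLength ⊤ P := by
  have h1 : relLength ⊤ (P.comap (LinearMap.fst A M M)) = relLength ⊤ P := by
    rw [relLength_comap, Submodule.map_top, LinearMap.range_eq_top.2 LinearMap.fst_surjective,
      top_sup_eq]
  have h2 : relLength (P.comap (LinearMap.fst A M M)) (P.comap (LinearMap.snd A M M)) =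
      relLength ⊤ P := by
    rw [relLength_comap]
    have : (P.comap (LinearMap.fst A M M)).map (LinearMap.snd A M M) = ⊤ := by
      rw [eq_top_iff]
      exact fun m _ => ⟨(0, m), P.zero_mem, rfl⟩
    rw [this, top_sup_eq]
  have e : P.prod P = P.comap (LinearMap.fst A M M) ⊓ P.comap (LinearMap.snd A M M) := rfl
  rw [relLength_add (V := P.comap (LinearMap.fst A M M)) le_top (e ▸ inf_le_left), h1, e,
    relLength_inf_right, h2]

/-- The Koszul complex of a regular sequence `x, y` computes the length of `N / (xP + yP)`. -/
theorem relLength_koszul {x y : A} (h : IsRegularPair x y M) {P Q N : Submodule A M}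
    (hQ : ∀ t, x • t ∈ P → t ∈ Q) (hx : ∀ t ∈ Q, x • t ∈ P) (hy : ∀ t ∈ Q, y • t ∈ P)
    (hN : mulSub x P ⊔ mulSub y P ≤ N) :
    relLength ⊤ N + relLength N (mulSub x P ⊔ mulSub y P) + relLength ⊤ Q =
      relLength ⊤ (mulSub x (⊤ : Submodule A M) ⊔ mulSub y ⊤) +
        (relLength ⊤ P + relLength ⊤ P) := by
  set U := mulSub x P ⊔ mulSub y P with hU
  let φ : M × M →ₗ[A] M := (LinearMap.lsmul A M x).coprod (LinearMap.lsmul A M y)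
  let ψ : M →ₗ[A] M × M := (LinearMap.lsmul A M y).prod (-LinearMap.lsmul A M x)
  have hφ : ∀ p : M × M, φ p = x • p.1 + y • p.2 := fun p => rfl
  have hUle : U ≤ mulSub x ⊤ ⊔ mulSub y ⊤ := sup_le_sup (mulSub_mono le_top) (mulSub_mono le_top)
  have hrange : (⊤ : Submodule A (M × M)).map φ = mulSub x ⊤ ⊔ mulSub y ⊤ := by
    rw [Submodule.map_top, LinearMap.range_coprod, ← Submodule.map_top, ← Submodule.map_top]
  have hPP : P.prod P ≤ U.comap φ := by
    rintro ⟨p, q⟩ ⟨hp, hq⟩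
    exact Submodule.add_mem_sup ⟨p, hp, rfl⟩ ⟨q, hq, rfl⟩
  -- Middle exactness of the Koszul complex: modulo P × P, a relation xp + yq ∈ U is a multiple of
  -- (y, -x).
  have hcomap : U.comap φ = (⊤ : Submodule A M).map ψ ⊔ P.prod P := by
    refine le_antisymm ?_ (sup_le ?_ hPP)
    · rintro ⟨p, q⟩ hpq
      obtain ⟨_, ⟨α, hα, rfl⟩, _, ⟨β, hβ, rfl⟩, e⟩ := Submodule.mem_sup.1 hpq
      have e' : x • α + y • β = x • p + y • q := e
      have e2 : y • (q - β) = x • (α - p) := by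
        rw [smul_sub, smul_sub, sub_eq_sub_iff_add_eq_add, add_comm, ← e', add_comm]
      obtain ⟨t, ht⟩ := h.right _ _ e2
      have e3 : α - p = y • t := h.cancel (by rw [← e2, ht, smul_comm])
      refine Submodule.mem_sup.2 ⟨ψ (-t), ⟨-t, trivial, rfl⟩, (α, β), ⟨hα, hβ⟩, ?_⟩
      refine Prod.ext ?_ ?_
      · change y • (-t) + α = p
        rw [smul_neg, ← e3]
        abel
      · change -(x • (-t)) + β = q
        rw [smul_neg, neg_neg, ← ht]
        abel
    · rintro _ ⟨t, -, rfl⟩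
      rw [Submodule.mem_comap, hφ]
      have : x • (ψ t).1 + y • (ψ t).2 = 0 := by
        change x • y • t + y • (-(x • t)) = 0
        rw [smul_neg, smul_comm, add_neg_cancel]
      rw [this]
      exact zero_mem _
  have hψ : (P.prod P).comap ψ = Q := by
    ext t
    constructor
    · rintro ⟨-, ht⟩
      exact hQ t (by simpa [ψ] using ht)
    · intro ht
      exact ⟨hy t ht, by simpa [ψ] using hx t ht⟩
  have e1 : relLength ⊤ (U.comap φ) = relLength (mulSub x ⊤ ⊔ mulSub y ⊤) U := by
    rw [relLength_comap, hrange, sup_eq_left.2 hUle]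
  have e2 : relLength (U.comap φ) (P.prod P) = relLength ⊤ Q := by
    rw [hcomap, ← relLength_comap, hψ]
  -- Count along M² ⊇ φ⁻¹(U) ⊇ P², then along M ⊇ (x, y)M ⊇ U and M ⊇ N ⊇ U.
  rw [← relLength_top_prod, relLength_add (V := U.comap φ) le_top hPP, e1, e2, ← add_assoc,
    ← relLength_add le_top hN, ← relLength_add le_top hUle]

end Count

/-! ### Superficial reductions of large degree. -/

section Reduction

variable {A : Type u} [CommRing A] {I : Ideal A} {M : Type v} [AddCommGroup M] [Module A M]

/-- `x, y ∈ Iᶜ` form a regular sequence on `M`, with `x` superficial and `(x, y)` a reduction. -/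
structure IsSuperficialReduction (I : Ideal A) (M : Type v) [AddCommGroup M] [Module A M]
    (c : ℕ) (x y : A) : Prop where
  left_mem : x ∈ I ^ c
  right_mem : y ∈ I ^ c
  pair : IsRegularPair x y M
  colon : ∃ N, ∀ n ≥ N, ∀ w : M, x • w ∈ I ^ (n + c) • (⊤ : Submodule A M) →
    w ∈ I ^ n • (⊤ : Submodule A M)
  generate : ∃ N, ∀ n ≥ N, I ^ (n + c) • (⊤ : Submodule A M) ≤
    mulSub x (I ^ n • ⊤) ⊔ mulSub y (I ^ n • ⊤)

/-- Artin–Rees and injectivity of x place w in I^N M; filter-regularity then raises its order one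
step at a time up to n. -/
theorem colon_of_filterRegular [IsNoetherianRing A] [Module.Finite A M] {x : A} {a : ℕ}
    (hx : ∀ m : M, x • m = 0 → m = 0)
    (hreg : ∃ N, ∀ n ≥ N, ∀ w ∈ I ^ n • (⊤ : Submodule A M),
        x • w ∈ I ^ (n + a + 1) • (⊤ : Submodule A M) → w ∈ I ^ (n + 1) • (⊤ : Submodule A M)) :
    ∃ N, ∀ n ≥ N, ∀ w : M, x • w ∈ I ^ (n + a) • (⊤ : Submodule A M) →
      w ∈ I ^ n • (⊤ : Submodule A M) := by
  obtain ⟨N, hN⟩ := hreg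
  obtain ⟨k, hk⟩ := I.exists_pow_inf_eq_pow_smul (mulSub x (⊤ : Submodule A M))
  refine ⟨N + k, fun n hn w hw => ?_⟩
  have h0 : w ∈ I ^ N • (⊤ : Submodule A M) := by
    have hmem : x • w ∈ I ^ (n + a) • (⊤ : Submodule A M) ⊓ mulSub x ⊤ := ⟨hw, w, trivial, rfl⟩
    rw [hk _ (by omega)] at hmem
    have hle : I ^ (n + a - k) • (I ^ k • (⊤ : Submodule A M) ⊓ mulSub x ⊤) ≤
        mulSub x (I ^ N • ⊤) := by
      refine (smul_mono_right _ inf_le_right).trans ?_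
      rw [smul_mulSub]
      exact mulSub_mono (Submodule.smul_mono_left (Ideal.pow_le_pow_right (by omega)))
    obtain ⟨w', hw', e⟩ := hle hmem
    have e0 : w' - w = 0 := hx _ (by rw [smul_sub, sub_eq_zero]; exact e)
    rwa [← sub_eq_zero.1 e0]
  have step : ∀ j, N ≤ j → j ≤ n → w ∈ I ^ j • (⊤ : Submodule A M) := by
    intro j hj
    induction j, hj using Nat.le_induction with
    | base => exact fun _ => h0
    | succ j hj ih =>
      intro hjn
      refine hN j hj w (ih (by omega)) ?_
      exact Submodule.smul_mono_left (Ideal.pow_le_pow_right (by omega)) hw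
  exact step n (by omega) le_rfl

/-- Cancelling one factor x at a time only meets orders at least n, so a single threshold serves
every i. This uniformity bounds the Ratliff–Rush closure, whose exponent depends on the element. -/
theorem colon_pow {x : A} {a : ℕ}
    (h : ∃ N, ∀ n ≥ N, ∀ w : M, x • w ∈ I ^ (n + a) • (⊤ : Submodule A M) →
      w ∈ I ^ n • (⊤ : Submodule A M)) :
    ∃ N, ∀ i, ∀ n ≥ N, ∀ w : M, x ^ i • w ∈ I ^ (n + i * a) • (⊤ : Submodule A M) →
      w ∈ I ^ n • (⊤ : Submodule A M) := by
  obtain ⟨N, hN⟩ := h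
  refine ⟨N, fun i => ?_⟩
  induction i with
  | zero => intro n _ w hw; simpa using hw
  | succ i ih =>
    intro n hn w hw
    refine ih n hn w (hN _ (by omega) _ ?_)
    rw [← mul_smul, ← pow_succ']
    convert hw using 3
    ring

/-- Parameters of degrees a and b are brought to the common degree c = ab(B + 1) by taking powers.
They are regular because (x, y) + ann M contains powers of a regular pair u, v. -/
theorem exists_isSuperficialReduction [IsLocalRing A] [IsNoetherianRing A] [Module.Finite A M]
    (hdim : Module.supportDim A M = 2) (hCM : IsCohenMacaulay A (maximalIdeal A) M)
    (hI : IsIdealOfDefinition I M) (B : ℕ) :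
    ∃ c ≥ B, ∃ x y, 1 ≤ c ∧ IsSuperficialReduction I M c x y := by
  obtain ⟨a, ha, b, hb, x, hx, y, hy, hreg, hgen⟩ := exists_parameters hdim hCM hI
  have hIm := hI.1
  have hxm : x ∈ maximalIdeal A := hIm (Ideal.pow_le_self (by omega) hx)
  have hym : y ∈ maximalIdeal A := hIm (Ideal.pow_le_self (by omega) hy)
  obtain ⟨u, hu, v, hv, huv, -⟩ := exists_regularPair hdim hCM
  have hrad : ∀ w ∈ maximalIdeal A,
      w ∈ (Ideal.span {x, y} ⊔ Module.annihilator A M).radical := by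
    intro w hw
    obtain ⟨-, k, hk⟩ := hI
    obtain ⟨N, hN⟩ := hgen
    refine mem_radical_of_pow_smul_top_le (k := k * N) fun m => ?_
    have h1 : w ^ (k * N) • m ∈ _ := pow_mul_smul_le hk N (Submodule.smul_mem_smul
      (Ideal.pow_mem_pow hw (k * N)) (trivial : m ∈ (⊤ : Submodule A M)))
    rw [span_pair_smul_top]
    have hle : mulSub x (I ^ (N - a) • (⊤ : Submodule A M)) ⊔ mulSub y (I ^ (N - b) • ⊤) ≤
        mulSub x ⊤ ⊔ mulSub y ⊤ := sup_le_sup (mulSub_mono le_top) (mulSub_mono le_top)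
    exact hle (hN N le_rfl h1)
  obtain ⟨s, hs⟩ := hrad u hu
  obtain ⟨t, ht⟩ := hrad v hv
  have hxy : IsRegularPair x y M :=
    ((huv.pow_left s).pow_right t).of_mem_sup_annihilator hym hs ht
  obtain ⟨N₁, hcolon⟩ := colon_pow (colon_of_filterRegular hxy.left hreg)
  have hgen' := eventually_le_mulSub_pow hx hgen (b * (B + 1))
  have hgen'' := eventually_le_mulSub_pow (b := b * (B + 1) * a) hy
    (hgen'.imp fun N h n hn => (h n hn).trans (sup_comm _ _).le) (a * (B + 1))
  have ec : a * (B + 1) * b = b * (B + 1) * a := by ring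
  have hpos : B + 1 ≤ b * (B + 1) * a := by
    have h1 : 1 * (B + 1) * 1 ≤ b * (B + 1) * a := by gcongr
    omega
  refine ⟨b * (B + 1) * a, by omega, x ^ (b * (B + 1)), y ^ (a * (B + 1)), by omega, ?_, ?_,
    (hxy.pow_left _).pow_right _, ⟨N₁, hcolon (b * (B + 1))⟩, ?_⟩
  · rw [mul_comm, pow_mul]
    exact Ideal.pow_mem_pow hx _
  · rw [← ec, mul_comm, pow_mul]
    exact Ideal.pow_mem_pow hy _
  · obtain ⟨N, hN⟩ := hgen''
    refine ⟨N, fun n hn => ?_⟩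
    have := hN (n + b * (B + 1) * a) (by omega)
    rw [ec, Nat.add_sub_cancel] at this
    exact this.trans (sup_comm _ _).le

end Reduction

/-! ### Saturation properties of the Ratliff–Rush filtration. -/

section RatliffRushFiltration

variable {A : Type u} [CommRing A] {I : Ideal A} {M : Type v} [AddCommGroup M] [Module A M]

theorem ratliffRush_zero : (ratliffRush I M).N 0 = ⊤ := by
  rw [eq_top_iff]
  exact fun w _ => ⟨0, fun a _ => by simp⟩

theorem le_ratliffRush (n : ℕ) : I ^ n • (⊤ : Submodule A M) ≤ (ratliffRush I M).N n :=
  fun _ hw => ⟨0, fun a _ => Submodule.smul_mem _ a hw⟩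

namespace IsSuperficialReduction

variable {c : ℕ} {x y : A}

/-- If I^k w ⊆ I^(n+k)M, then x^k w ∈ I^(n+kc)M, and x^k cancels for n beyond a bound independent of
k. -/
theorem exists_ratliffRush_eq (h : IsSuperficialReduction I M c x y) (hc : 1 ≤ c) :
    ∃ N, ∀ n ≥ N, (ratliffRush I M).N n = I ^ n • (⊤ : Submodule A M) := by
  obtain ⟨N, hN⟩ := colon_pow h.colon
  refine ⟨N, fun n hn => le_antisymm ?_ (le_ratliffRush n)⟩
  rintro w ⟨k, hk⟩
  refine hN k n hn w (colon_mono (l := k * c) (Nat.le_mul_of_pos_right k hc) hk _ ?_)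
  rw [mul_comm, pow_mul]
  exact Ideal.pow_mem_pow h.left_mem k

/-- Multiplying by a high power of I moves the question to degrees where x cancels for the adic
filtration; the closure absorbs that power. -/
theorem mem_of_smul_mem_ratliffRush (h : IsSuperficialReduction I M c x y) {j : ℕ} {w : M}
    (hw : x • w ∈ (ratliffRush I M).N (j + c)) : w ∈ (ratliffRush I M).N j := by
  obtain ⟨N, hN⟩ := h.colon
  obtain ⟨k, hk⟩ := hw
  refine ⟨k + N, fun e he => hN _ (by omega) _ ?_⟩
  have := colon_mono (l := k + N) (by omega) hk e he
  rw [smul_comm]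
  convert this using 3
  omega

theorem mem_of_forall_smul_mem_ratliffRush (h : IsSuperficialReduction I M c x y) (hc : 1 ≤ c)
    {n k : ℕ} {w : M} (hw : ∀ e ∈ I ^ k, e • w ∈ (ratliffRush I M).N (n + k)) :
    w ∈ (ratliffRush I M).N n := by
  obtain ⟨N, hN⟩ := h.exists_ratliffRush_eq hc
  refine ⟨N + k, fun e he => ?_⟩
  rw [pow_add] at he
  refine Submodule.mul_induction_on he (fun a ha b hb => ?_) (fun a b ha hb => ?_)
  · have := filtration_smul_mem (ratliffRush I M) ha (hw b hb)
    rw [hN _ (by omega)] at this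
    rw [mul_smul]
    convert this using 3
    omega
  · rw [add_smul]
    exact add_mem ha hb

end IsSuperficialReduction

end RatliffRushFiltration

/-! ### Hilbert series, h-polynomials and colengths. -/

section HilbertSeries

open Polynomial in
-- The coefficient of degree n + 2 in (1 - X)² ∑ f(n)Xⁿ is the second difference of f at n.
theorem exists_polynomial_eq_of_eventuallyPoly {f : ℕ → ℤ} (hf : EventuallyPoly 2 f) :
    ∃ h : ℤ[X], (h : PowerSeries ℤ) = (1 - PowerSeries.X) ^ 2 * PowerSeries.mk f := by
  obtain ⟨N, hN⟩ := hf
  refine ⟨PowerSeries.trunc (N + 2) ((1 - PowerSeries.X) ^ 2 * PowerSeries.mk f), ?_⟩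
  ext n
  rw [Polynomial.coeff_coe, PowerSeries.coeff_trunc]
  split_ifs with h
  · rfl
  · obtain ⟨m, rfl⟩ : ∃ m, n = m + 2 := ⟨n - 2, by omega⟩
    have h0 := hN m (by omega)
    have e : (1 - PowerSeries.X) ^ 2 * PowerSeries.mk f = PowerSeries.mk f -
        PowerSeries.X * PowerSeries.mk f - PowerSeries.X * PowerSeries.mk f +
        PowerSeries.X * (PowerSeries.X * PowerSeries.mk f) := by ring
    rw [e]
    simp only [map_add, map_sub, PowerSeries.coeff_succ_X_mul, PowerSeries.coeff_mk]
    simp only [Function.iterate_succ_apply, Function.iterate_zero, id, diff] at h0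
    rw [show m + 1 + 1 = m + 2 from rfl] at h0
    linarith

variable {A : Type u} [CommRing A] {I : Ideal A} {M : Type v} [AddCommGroup M] [Module A M]

theorem dim_eq_two (hdim : Module.supportDim A M = 2) : dim A M = 2 := by
  rw [dim, hdim]
  rfl

theorem exists_isHPolynomial (hdim : Module.supportDim A M = 2) {F : I.Filtration M}
    (hF : EventuallyPoly 2 (fun n => (hilbertFunction F n : ℤ))) : ∃ h, IsHPolynomial F h := by
  obtain ⟨h, hh⟩ := exists_polynomial_eq_of_eventuallyPoly hF
  refine ⟨h, ?_⟩
  rw [IsHPolynomial, dim_eq_two hdim]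
  exact hh

open Polynomial in
-- The coefficients of r will measure how far the colengths deviate from their polynomial.
theorem exists_taylor_expansion (h : ℤ[X]) : ∃ r : ℤ[X], h = C (h.eval 1) +
    C ((hasseDeriv 1 h).eval 1) * (X - 1) + C ((hasseDeriv 2 h).eval 1) * (X - 1) ^ 2 +
      (X - 1) ^ 3 * r := by
  have e0 := (taylor 1 h).divX_mul_X_add
  have e1 := (taylor 1 h).divX.divX_mul_X_add
  have e2 := (taylor 1 h).divX.divX.divX_mul_X_add
  simp only [coeff_divX, taylor_coeff, zero_add, hasseDeriv_zero', one_add_one_eq_two] at e0 e1 e2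
  refine ⟨taylor (-1) (taylor 1 h).divX.divX.divX, ?_⟩
  have e : taylor (-1) (taylor 1 h) = h := by
    rw [taylor_taylor]; simp
  have hX : taylor (-1 : ℤ) X = X - 1 := by
    rw [taylor_X]; simp [sub_eq_add_neg]
  have hmul : ∀ f g : ℤ[X], taylor (-1 : ℤ) (f * g) = taylor (-1) f * taylor (-1) g :=
    fun f g => taylor_mul _ _ _
  conv_lhs => rw [← e, ← e0, ← e1, ← e2]
  simp only [map_add, hmul, hX, taylor_C]
  ring

theorem sum_hilbertFunction {F : I.Filtration M} (h0 : F.N 0 = ⊤)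
    (hF : ∀ n, relLength ⊤ (F.N n) ≠ ⊤) :
    (1 - PowerSeries.X) * PowerSeries.mk (fun n => colength F (n + 1)) = hilbertSeries F := by
  have hz : colength F 0 = 0 := by
    rw [colength, h0, relLength_eq_zero_iff.2 le_rfl]; rfl
  ext n
  rw [sub_mul, one_mul, map_sub, hilbertSeries, PowerSeries.coeff_mk, PowerSeries.coeff_mk]
  cases n with
  | zero => rw [PowerSeries.coeff_zero_X_mul, colength_succ hF, hz]; ring
  | succ n =>
    rw [PowerSeries.coeff_succ_X_mul, PowerSeries.coeff_mk, colength_succ hF (n + 1)]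
    ring

open Polynomial in
/-- The colengths of a filtration in terms of the Taylor expansion of its `h`-polynomial. -/
theorem IsHPolynomial.colength_eq (hdim : Module.supportDim A M = 2) {F : I.Filtration M}
    (h0 : F.N 0 = ⊤) (hF : ∀ n, relLength ⊤ (F.N n) ≠ ⊤) {h r : ℤ[X]} {a b c : ℤ}
    (hh : IsHPolynomial F h)
    (hr : h = C a + C b * (X - 1) + C c * (X - 1) ^ 2 + (X - 1) ^ 3 * r) (n : ℕ) :
    2 * colength F (n + 1) =
      a * ((n + 2) * (n + 1)) - 2 * b * (n + 1) + 2 * c - 2 * r.coeff n := by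
  have hh' : (h : PowerSeries ℤ) =
      (1 - PowerSeries.X) ^ 3 * PowerSeries.mk (fun n => colength F (n + 1)) := by
    rw [hh, dim_eq_two hdim, ← sum_hilbertFunction h0 hF]
    ring
  have m2 := PowerSeries.mk_add_choose_mul_one_sub_pow_eq_one (S := ℤ) (d := 2)
  have m1 := PowerSeries.mk_add_choose_mul_one_sub_pow_eq_one (S := ℤ) (d := 1)
  have m0 := PowerSeries.mk_add_choose_mul_one_sub_pow_eq_one (S := ℤ) (d := 0)
  set s2 := PowerSeries.mk (fun n => ((2 + n).choose 2 : ℤ))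
  set s1 := PowerSeries.mk (fun n => ((1 + n).choose 1 : ℤ))
  set s0 := PowerSeries.mk (fun n => ((0 + n).choose 0 : ℤ))
  -- Divide the Taylor expansion by (1 - X)³: powers of X - 1 become binomial series with
  -- alternating signs, and the remainder becomes -r.
  have key : PowerSeries.mk (fun n => colength F (n + 1)) =
      PowerSeries.C a * s2 - PowerSeries.C b * s1 + PowerSeries.C c * s0 - (r : PowerSeries ℤ) := by
    have hne : (1 - PowerSeries.X : PowerSeries ℤ) ^ 3 ≠ 0 := by
      intro hz
      rw [hz, mul_zero] at m2
      exact zero_ne_one m2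
    refine mul_left_cancel₀ hne ?_
    rw [← hh', hr]
    push_cast
    linear_combination (-PowerSeries.C a) * m2 + PowerSeries.C b * (1 - PowerSeries.X) * m1 -
      PowerSeries.C c * (1 - PowerSeries.X) ^ 2 * m0
  have hn := congrArg (PowerSeries.coeff n) key
  simp only [map_add, map_sub, PowerSeries.coeff_mk, PowerSeries.coeff_C_mul, s2, s1, s0,
    Polynomial.coeff_coe, Nat.choose_one_right, Nat.choose_zero_right] at hn
  have hch : (((2 + n).choose 2 : ℕ) : ℤ) * 2 = (n + 2) * (n + 1) := by
    have h2 : (2 + n).choose 2 * 2 = (n + 2) * (n + 1) := by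
      rw [add_comm, Nat.choose_two_right,
        Nat.div_mul_cancel (Nat.even_mul_pred_self (n + 2)).two_dvd]
      rfl
    exact_mod_cast h2
  push_cast at hn
  rw [hn]
  linear_combination a * hch

open Polynomial in
/-- Filtrations with eventually equal colengths have the same second Hilbert coefficient. -/
theorem IsHPolynomial.hasseDeriv_two_eval_eq (hdim : Module.supportDim A M = 2)
    {F G : I.Filtration M} (hF0 : F.N 0 = ⊤) (hF : ∀ n, relLength ⊤ (F.N n) ≠ ⊤)
    (hG0 : G.N 0 = ⊤) (hG : ∀ n, relLength ⊤ (G.N n) ≠ ⊤) {h g : ℤ[X]}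
    (hh : IsHPolynomial F h) (hg : IsHPolynomial G g)
    (heq : ∃ N, ∀ n ≥ N, colength F n = colength G n) :
    (hasseDeriv 2 h).eval 1 = (hasseDeriv 2 g).eval 1 := by
  obtain ⟨r, hr⟩ := exists_taylor_expansion h
  obtain ⟨s, hs⟩ := exists_taylor_expansion g
  obtain ⟨N, hN⟩ := heq
  have key := fun n => hh.colength_eq hdim hF0 hF hr n
  have key' := fun n => hg.colength_eq hdim hG0 hG hs n
  set a := h.eval 1
  set a' := g.eval 1
  set b := (hasseDeriv 1 h).eval 1
  set b' := (hasseDeriv 1 g).eval 1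
  set c := (hasseDeriv 2 h).eval 1
  set c' := (hasseDeriv 2 g).eval 1
  set n := N + r.natDegree + s.natDegree + 1
  have hq : ∀ m ≥ n, (a - a') * ((m + 2) * (m + 1)) - 2 * (b - b') * (m + 1) + 2 * (c - c') = 0 := by
    intro m hm
    have h1 := key m
    have h2 := key' m
    rw [coeff_eq_zero_of_natDegree_lt (by omega)] at h1 h2
    rw [hN (m + 1) (by omega)] at h1
    linarith
  -- Beyond the degrees of r and s the two quadratics agree; three consecutive values determine
  -- their coefficients.
  have q0 := hq n le_rfl
  have q1 := hq (n + 1) (by omega)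
  have q2 := hq (n + 2) (by omega)
  push_cast at q1 q2
  have ha : a - a' = 0 := by linarith
  rw [ha] at q0 q1
  have hb : b - b' = 0 := by linarith
  rw [hb] at q0
  linarith

end HilbertSeries

/-! ### Consequences of e₂ = 0. -/

section VanishingSecondCoefficient

variable {A : Type u} [CommRing A] {I : Ideal A} {M : Type v} [AddCommGroup M] [Module A M]
  {c : ℕ} {x y : A}

namespace IsSuperficialReduction

theorem mulSub_sup_le (h : IsSuperficialReduction I M c x y) (n : ℕ) :
    mulSub x ((ratliffRush I M).N (n + c)) ⊔ mulSub y ((ratliffRush I M).N (n + c)) ≤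
      (ratliffRush I M).N (n + c + c) := by
  refine sup_le ?_ ?_
  · rintro _ ⟨w, hw, rfl⟩
    exact filtration_smul_mem _ h.left_mem hw
  · rintro _ ⟨w, hw, rfl⟩
    exact filtration_smul_mem _ h.right_mem hw

theorem colength_add (h : IsSuperficialReduction I M c x y)
    (hF : ∀ n, relLength ⊤ ((ratliffRush I M).N n) ≠ ⊤)
    (hL : relLength ⊤ (mulSub x (⊤ : Submodule A M) ⊔ mulSub y ⊤) ≠ ⊤) (n : ℕ) :
    colength (ratliffRush I M) (n + c + c) + (relLength ((ratliffRush I M).N (n + c + c))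
      (mulSub x ((ratliffRush I M).N (n + c)) ⊔ mulSub y ((ratliffRush I M).N (n + c)))).toNat +
      colength (ratliffRush I M) n =
    (relLength ⊤ (mulSub x (⊤ : Submodule A M) ⊔ mulSub y ⊤)).toNat +
      2 * colength (ratliffRush I M) (n + c) ∧
    relLength ((ratliffRush I M).N (n + c + c))
      (mulSub x ((ratliffRush I M).N (n + c)) ⊔ mulSub y ((ratliffRush I M).N (n + c))) ≠ ⊤ := by
  have hadd : ∀ {p q : ℕ∞}, p ≠ ⊤ → q ≠ ⊤ → p + q ≠ ⊤ := fun hp hq htop =>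
    (ENat.add_eq_top.1 htop).elim hp hq
  have key := relLength_koszul h.pair (P := (ratliffRush I M).N (n + c))
    (Q := (ratliffRush I M).N n) (N := (ratliffRush I M).N (n + c + c))
    (fun t ht => h.mem_of_smul_mem_ratliffRush ht)
    (fun t ht => filtration_smul_mem _ h.left_mem ht)
    (fun t ht => filtration_smul_mem _ h.right_mem ht) (h.mulSub_sup_le n)
  have hfin : relLength ((ratliffRush I M).N (n + c + c))
      (mulSub x ((ratliffRush I M).N (n + c)) ⊔ mulSub y ((ratliffRush I M).N (n + c))) ≠ ⊤ := by
    intro htop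
    rw [htop] at key
    have h2 : relLength ⊤ (mulSub x (⊤ : Submodule A M) ⊔ mulSub y ⊤) +
        (relLength ⊤ ((ratliffRush I M).N (n + c)) +
          relLength ⊤ ((ratliffRush I M).N (n + c))) ≠ ⊤ :=
      hadd hL (hadd (hF _) (hF _))
    rw [← key, add_top, top_add] at h2
    exact h2 rfl
  refine ⟨?_, hfin⟩
  have := congrArg ENat.toNat key
  rw [ENat.toNat_add (hadd (hF _) hfin) (hF _), ENat.toNat_add (hF _) hfin,
    ENat.toNat_add hL (hadd (hF _) (hF _)), ENat.toNat_add (hF _) (hF _)] at this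
  rw [colength, colength, colength]
  zify at this
  rw [this]
  ring

open Polynomial in
/-- If the second Hilbert coefficient of the Ratliff-Rush filtration vanishes, then the filtration
is generated by `x, y` in degrees at least `2c`, and its `h`-polynomial is linear. -/
theorem of_hasseDeriv_two_eval_eq_zero (h : IsSuperficialReduction I M c x y)
    (hdim : Module.supportDim A M = 2) (hc : 1 ≤ c)
    (hF : ∀ n, relLength ⊤ ((ratliffRush I M).N n) ≠ ⊤)
    (hL : relLength ⊤ (mulSub x (⊤ : Submodule A M) ⊔ mulSub y ⊤) ≠ ⊤)
    (hadic : ∀ n ≥ c, (ratliffRush I M).N n = I ^ n • (⊤ : Submodule A M))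
    {f r : ℤ[X]} (hf : IsHPolynomial (ratliffRush I M) f)
    (hr : f = C (f.eval 1) + C ((hasseDeriv 1 f).eval 1) * (X - 1) +
      C ((hasseDeriv 2 f).eval 1) * (X - 1) ^ 2 + (X - 1) ^ 3 * r) (hrc : r.natDegree + 1 < c)
    (he : (hasseDeriv 2 f).eval 1 = 0) :
    (∀ n, (ratliffRush I M).N (n + c + c) ≤
      mulSub x ((ratliffRush I M).N (n + c)) ⊔ mulSub y ((ratliffRush I M).N (n + c))) ∧
    f.natDegree ≤ 1 := by
  have key := fun n => hf.colength_eq hdim ratliffRush_zero hF hr n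
  have hsum := h.colength_add hF hL
  rw [he] at key hr
  set a := f.eval 1
  set b := (hasseDeriv 1 f).eval 1
  set F := ratliffRush I M
  set L : ℤ := ((relLength ⊤ (mulSub x (⊤ : Submodule A M) ⊔ mulSub y ⊤)).toNat : ℤ)
  -- The bound on c puts n - 1 beyond the degree of r. There is no constant term because e₂ = 0.
  have hpoly : ∀ n ≥ c, 2 * colength F n = a * ((n + 1) * n) - 2 * b * n := by
    intro n hn
    obtain ⟨m, rfl⟩ : ∃ m, n = m + 1 := ⟨n - 1, by omega⟩
    rw [key m, coeff_eq_zero_of_natDegree_lt (by omega)]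
    push_cast
    ring
  -- In high degree the reduction leaves no defect, so L is the second difference, with step c, of
  -- the colength polynomial.
  have hLc : L = a * c ^ 2 := by
    obtain ⟨N, hN⟩ := h.generate
    obtain ⟨h1, -⟩ := hsum (N + c)
    have hz : relLength (F.N (N + c + c + c)) (mulSub x (F.N (N + c + c)) ⊔
        mulSub y (F.N (N + c + c))) = 0 := by
      rw [relLength_eq_zero_iff, hadic _ (by omega), hadic _ (by omega)]
      exact hN _ (by omega)
    rw [hz] at h1
    have p0 := hpoly (N + c) (by omega)
    have p1 := hpoly (N + c + c) (by omega)
    have p2 := hpoly (N + c + c + c) (by omega)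
    push_cast at p0 p1 p2 h1
    simp only [ENat.toNat_zero, Nat.cast_zero, add_zero] at h1
    have : 2 * L = 2 * (a * c ^ 2) := by
      linear_combination (-2) * h1 + p2 + p0 - 2 * p1
    linarith
  -- The polynomial also gives the true colength 0 at n = 0, so the same second difference leaves no
  -- room for a defect there.
  have hbase : F.N (0 + c + c) ≤ mulSub x (F.N (0 + c)) ⊔ mulSub y (F.N (0 + c)) := by
    obtain ⟨h1, h2⟩ := hsum 0
    have hz : colength F 0 = 0 := by
      rw [colength, ratliffRush_zero, relLength_eq_zero_iff.2 le_rfl]; rfl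
    have p1 := hpoly (0 + c) (by omega)
    have p2 := hpoly (0 + c + c) (by omega)
    push_cast at p1 p2
    rw [hz, hLc] at h1
    have h3 : (2 : ℤ) * ((relLength (F.N (0 + c + c))
        (mulSub x (F.N (0 + c)) ⊔ mulSub y (F.N (0 + c)))).toNat : ℤ) = 0 := by
      linear_combination 2 * h1 - p2 + 2 * p1
    have h4 : (relLength (F.N (0 + c + c))
        (mulSub x (F.N (0 + c)) ⊔ mulSub y (F.N (0 + c)))).toNat = 0 := by omega
    exact relLength_eq_zero_iff.1 ((ENat.toNat_eq_zero.1 h4).resolve_right h2)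
  have hall : ∀ n, F.N (n + c + c) ≤ mulSub x (F.N (n + c)) ⊔ mulSub y (F.N (n + c)) := by
    intro n
    have e : F.N (n + c + c) = I ^ n • F.N (0 + c + c) := by
      rw [hadic _ (by omega), hadic _ (by omega), ← Submodule.mul_smul, ← pow_add]
      congr 2
      omega
    rw [e]
    refine (smul_mono_right _ hbase).trans ?_
    rw [Submodule.smul_sup, smul_mulSub, smul_mulSub]
    have e' : I ^ n • F.N (0 + c) ≤ F.N (n + c) := by
      rw [zero_add]
      exact F.pow_smul_le n c
    exact sup_le_sup (mulSub_mono e') (mulSub_mono e')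
  refine ⟨hall, ?_⟩
  -- With no defect, the Koszul identity determines λ(M/F_(n+1)) from colengths in degrees at least
  -- c, where the polynomial is exact.
  have hr0 : r = 0 := by
    ext n
    obtain ⟨h1, -⟩ := hsum (n + 1)
    rw [relLength_eq_zero_iff.2 (hall (n + 1)), hLc] at h1
    have p1 := hpoly (n + 1 + c) (by omega)
    have p2 := hpoly (n + 1 + c + c) (by omega)
    have p0 := key n
    push_cast at p1 p2 h1
    simp only [ENat.toNat_zero, Nat.cast_zero, add_zero] at h1
    rw [coeff_zero]
    have : 2 * r.coeff n = 0 := by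
      linear_combination (-2) * h1 + p2 - 2 * p1 + p0
    omega
  rw [hr0, mul_zero, add_zero, C_0, zero_mul, add_zero] at hr
  rw [hr]
  refine (natDegree_add_le _ _).trans (max_le (by simp) ?_)
  refine (natDegree_C_mul_le _ _).trans ?_
  rw [← C_1]
  exact natDegree_X_sub_C_le _

end IsSuperficialReduction

end VanishingSecondCoefficient

/-! ### Regularity of the initial forms. -/

section AssociatedGraded

variable {A : Type u} [CommRing A] {I : Ideal A} {M : Type v} [AddCommGroup M] [Module A M]
  {c : ℕ} {x y : A}

/-- This is regularity of the initial form of y modulo that of x, in one degree. If c ≤ n, write yz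
- xw = xα + yβ with α, β ∈ F_(n+1); regularity on M gives z - β = xg. If n < c, multiply by
I^(c-1-n) to reach F_(2c) and descend by saturation. -/
theorem IsSuperficialReduction.mem_or_exists_of_smul_sub_mem
    (h : IsSuperficialReduction I M c x y) (hc : 1 ≤ c)
    (hgen : ∀ n, (ratliffRush I M).N (n + c + c) ≤
      mulSub x ((ratliffRush I M).N (n + c)) ⊔ mulSub y ((ratliffRush I M).N (n + c)))
    {n : ℕ} {z w : M} (hz : z ∈ (ratliffRush I M).N n)
    (hyz : y • z - x • w ∈ (ratliffRush I M).N (n + c + 1)) :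
    z ∈ (ratliffRush I M).N (n + 1) ∨
      c ≤ n ∧ ∃ g ∈ (ratliffRush I M).N (n - c), z - x • g ∈ (ratliffRush I M).N (n + 1) := by
  have key : ∀ j (z w : M), y • z - x • w ∈ (ratliffRush I M).N (j + c + c) →
      ∃ g, z - x • g ∈ (ratliffRush I M).N (j + c) := by
    intro j z w hj
    obtain ⟨_, ⟨α, hα, rfl⟩, _, ⟨β, hβ, rfl⟩, e⟩ := Submodule.mem_sup.1 (hgen j hj)
    have e' : x • α + y • β = y • z - x • w := e
    have e2 : y • (z - β) = x • (w + α) := by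
      rw [smul_sub, smul_add, sub_eq_iff_eq_add, add_assoc, e']
      abel
    obtain ⟨g, hg⟩ := h.pair.right _ _ e2
    exact ⟨g, by rwa [← hg, sub_sub_cancel]⟩
  have low : ∀ z w : M, y • z - x • w ∈ (ratliffRush I M).N (c + c) →
      z ∈ (ratliffRush I M).N c := by
    intro z w hzw
    obtain ⟨g, hg⟩ := key 0 z w (by rwa [zero_add])
    rw [zero_add] at hg
    have hxg : x • g ∈ (ratliffRush I M).N c := by
      have := filtration_smul_mem (ratliffRush I M) (n := 0) (w := g) h.left_mem
        (by rw [ratliffRush_zero]; trivial)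
      rwa [zero_add] at this
    simpa using add_mem hg hxg
  by_cases hn : c ≤ n
  · refine Or.inr ⟨hn, ?_⟩
    obtain ⟨g, hg⟩ := key (n + 1 - c) z w (by
      rwa [Nat.sub_add_cancel (by omega), add_right_comm])
    rw [Nat.sub_add_cancel (by omega)] at hg
    refine ⟨g, h.mem_of_smul_mem_ratliffRush ?_, hg⟩
    rw [Nat.sub_add_cancel hn]
    have := sub_mem hz ((ratliffRush I M).mono n hg)
    rwa [sub_sub_cancel] at this
  · refine Or.inl (h.mem_of_forall_smul_mem_ratliffRush hc (k := c - 1 - n) fun e he => ?_)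
    rw [show n + 1 + (c - 1 - n) = c by omega]
    refine low (e • z) (e • w) ?_
    have := filtration_smul_mem _ he hyz
    rw [show n + c + 1 + (c - 1 - n) = c + c by omega, smul_sub, smul_comm, smul_comm e x] at this
    exact this

/-- The homogeneous element `m tⁿ` of the Rees module, for `m ∈ F_n`. -/
noncomputable def reesSingle (F : I.Filtration M) (n : ℕ) (m : M) (hm : m ∈ F.N n) :
    ReesModule F :=
  ⟨PolynomialModule.single A n m, by
    rw [← Ideal.Filtration.submodule_span_single]
    exact Submodule.subset_span (Set.mem_iUnion.2 ⟨n, m, hm, rfl⟩)⟩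

theorem reesSingle_coeff_self (F : I.Filtration M) (n : ℕ) (m : M) (hm : m ∈ F.N n) :
    (reesSingle F n m hm).1.coeff n = m :=
  Finsupp.single_eq_same

/-- The initial form in degree `n` of `m ∈ F_n`. -/
noncomputable def initialForm (F : I.Filtration M) (n : ℕ) (m : M) (hm : m ∈ F.N n) :
    AssocGradedModule F :=
  toAssocGradedModule F (reesSingle F n m hm)

theorem toAssocGradedModule_eq_zero_iff {F : I.Filtration M} {f : ReesModule F} :
    toAssocGradedModule F f = 0 ↔ ∀ n, f.1.coeff n ∈ F.N (n + 1) := by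
  rw [← LinearMap.mem_ker, ker_toAssocGradedModule]
  rfl

theorem reesMonomial_smul_coeff_add {F : I.Filtration M} (hx : x ∈ I ^ c) (f : ReesModule F)
    (n : ℕ) : (reesMonomial c x hx • f : ReesModule F).1.coeff (n + c) = x • f.1.coeff n := by
  have := PolynomialModule.monomial_smul_apply c x f.1 (n + c)
  rw [if_pos (Nat.le_add_left _ _), Nat.add_sub_cancel] at this
  exact this

theorem reesMonomial_smul_coeff_of_lt {F : I.Filtration M} (hx : x ∈ I ^ c) (f : ReesModule F)
    {n : ℕ} (hn : n < c) : (reesMonomial c x hx • f : ReesModule F).1.coeff n = 0 := by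
  have := PolynomialModule.monomial_smul_apply c x f.1 n
  rw [if_neg (by omega)] at this
  exact this

namespace IsSuperficialReduction

theorem isSMulRegular_left (h : IsSuperficialReduction I M c x y) :
    IsSMulRegular (AssocGradedModule (ratliffRush I M))
      (toAssocGradedRing I (reesMonomial c x h.left_mem)) := by
  rw [isSMulRegular_iff_right_eq_zero_of_smul]
  intro q hq
  obtain ⟨f, rfl⟩ := toAssocGradedModule_surjective _ q
  rw [toAssocGradedRing_smul, ← map_smul, toAssocGradedModule_eq_zero_iff] at hq
  rw [toAssocGradedModule_eq_zero_iff]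
  intro n
  have := hq (n + c)
  rw [reesMonomial_smul_coeff_add, add_right_comm] at this
  exact h.mem_of_smul_mem_ratliffRush this

theorem isSMulRegular_right (h : IsSuperficialReduction I M c x y) (hc : 1 ≤ c)
    (hgen : ∀ n, (ratliffRush I M).N (n + c + c) ≤
      mulSub x ((ratliffRush I M).N (n + c)) ⊔ mulSub y ((ratliffRush I M).N (n + c))) :
    IsSMulRegular (QuotSMulTop (toAssocGradedRing I (reesMonomial c x h.left_mem))
      (AssocGradedModule (ratliffRush I M)))
      (toAssocGradedRing I (reesMonomial c y h.right_mem)) := by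
  classical
  rw [isSMulRegular_quotient_iff_mem_of_smul_mem]
  intro q hq
  obtain ⟨p, -, hp⟩ := hq
  obtain ⟨f, rfl⟩ := toAssocGradedModule_surjective _ q
  obtain ⟨g, rfl⟩ := toAssocGradedModule_surjective _ p
  have h0 : toAssocGradedModule (ratliffRush I M)
      (reesMonomial c y h.right_mem • f - reesMonomial c x h.left_mem • g) = 0 := by
    rw [map_sub, map_smul, map_smul, sub_eq_zero]
    exact hp.symm
  rw [toAssocGradedModule_eq_zero_iff] at h0
  have hcoeff : ∀ n, y • f.1.coeff n - x • g.1.coeff n ∈ (ratliffRush I M).N (n + c + 1) := by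
    intro n
    have := h0 (n + c)
    rwa [← reesMonomial_smul_coeff_add h.right_mem, ← reesMonomial_smul_coeff_add h.left_mem]
  -- The quotient is chosen zero wherever f vanishes, so that the chosen family has finite support.
  have hex : ∀ n, ∃ s : M, s ∈ (ratliffRush I M).N n ∧ (f.1.coeff (n + c) = 0 → s = 0) ∧
      f.1.coeff (n + c) - x • s ∈ (ratliffRush I M).N (n + c + 1) := by
    intro n
    by_cases hf0 : f.1.coeff (n + c) = 0
    · exact ⟨0, zero_mem _, fun _ => rfl, by rw [hf0, smul_zero, sub_zero]; exact zero_mem _⟩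
    · rcases h.mem_or_exists_of_smul_sub_mem hc hgen (f.2 (n + c)) (hcoeff (n + c)) with
        h1 | ⟨-, s, hs, hs'⟩
      · exact ⟨0, zero_mem _, fun _ => rfl, by rwa [smul_zero, sub_zero]⟩
      · rw [Nat.add_sub_cancel] at hs
        exact ⟨s, hs, fun e => absurd e hf0, hs'⟩
  choose s hs hs0 hs1 using hex
  let sf : ℕ →₀ M := Finsupp.onFinset (f.1.coeff.support.image (· - c)) s fun n hn => by
    rw [Finset.mem_image]
    refine ⟨n + c, ?_, Nat.add_sub_cancel _ _⟩
    rw [Finsupp.mem_support_iff]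
    exact fun e => hn (hs0 n e)
  let sr : ReesModule (ratliffRush I M) := ⟨PolynomialModule.ofCoeff A sf, fun n => hs n⟩
  have hsr : ∀ n, sr.1.coeff n = s n := fun n => rfl
  refine ⟨toAssocGradedModule _ sr, trivial, ?_⟩
  refine (sub_eq_zero.1 ?_).symm
  change toAssocGradedModule _ f - toAssocGradedModule _ (reesMonomial c x h.left_mem • sr) = 0
  rw [← map_sub, toAssocGradedModule_eq_zero_iff]
  intro n
  change f.1.coeff n - (reesMonomial c x h.left_mem • sr).1.coeff n ∈ _
  by_cases hn : c ≤ n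
  · obtain ⟨m, rfl⟩ : ∃ m, n = m + c := ⟨n - c, by omega⟩
    rw [reesMonomial_smul_coeff_add, hsr]
    exact hs1 m
  · rw [reesMonomial_smul_coeff_of_lt _ _ (by omega), sub_zero]
    exact (h.mem_or_exists_of_smul_sub_mem hc hgen (f.2 n) (hcoeff n)).resolve_right
      fun h => hn h.1

/-- Elements of `(X, Y) G` have trivial constant term if `X`, `Y` have positive degree. -/
theorem coeff_zero_mem (h : IsSuperficialReduction I M c x y) (hc : 1 ≤ c)
    {q : AssocGradedModule (ratliffRush I M)}
    (hq : q ∈ Ideal.ofList [toAssocGradedRing I (reesMonomial c x h.left_mem),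
      toAssocGradedRing I (reesMonomial c y h.right_mem)] •
        (⊤ : Submodule (AssocGradedRing I) (AssocGradedModule (ratliffRush I M))))
    {f : ReesModule (ratliffRush I M)} (hf : toAssocGradedModule _ f = q) :
    f.1.coeff 0 ∈ (ratliffRush I M).N 1 := by
  have hmono : ∀ (z : A) (hz : z ∈ I ^ c) (p : AssocGradedModule (ratliffRush I M)),
      ∃ g, toAssocGradedModule (ratliffRush I M) g = toAssocGradedRing I (reesMonomial c z hz) • p ∧
        g.1.coeff 0 ∈ (ratliffRush I M).N 1 := by
    intro z hz p
    obtain ⟨g, rfl⟩ := toAssocGradedModule_surjective _ p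
    refine ⟨reesMonomial c z hz • g, map_smul _ _ _, ?_⟩
    rw [reesMonomial_smul_coeff_of_lt hz g (by omega)]
    exact zero_mem _
  have hadd : ∀ p q : AssocGradedModule (ratliffRush I M),
      (∃ g, toAssocGradedModule _ g = p ∧ g.1.coeff 0 ∈ (ratliffRush I M).N 1) →
      (∃ g, toAssocGradedModule _ g = q ∧ g.1.coeff 0 ∈ (ratliffRush I M).N 1) →
      ∃ g, toAssocGradedModule _ g = p + q ∧ g.1.coeff 0 ∈ (ratliffRush I M).N 1 := by
    rintro _ _ ⟨g, rfl, hg⟩ ⟨g', rfl, hg'⟩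
    exact ⟨g + g', map_add _ _ _, add_mem hg hg'⟩
  have key : ∃ g, toAssocGradedModule _ g = q ∧ g.1.coeff 0 ∈ (ratliffRush I M).N 1 := by
    refine Submodule.smul_induction_on hq (fun r hr p _ => ?_) hadd
    rw [Ideal.ofList_cons, Ideal.ofList_singleton] at hr
    obtain ⟨r1, hr1, r2, hr2, rfl⟩ := Submodule.mem_sup.1 hr
    obtain ⟨s1, rfl⟩ := Ideal.mem_span_singleton'.1 hr1
    obtain ⟨s2, rfl⟩ := Ideal.mem_span_singleton'.1 hr2
    rw [add_smul, mul_comm, mul_smul, mul_comm s2, mul_smul]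
    exact hadd _ _ (hmono x h.left_mem _) (hmono y h.right_mem _)
  obtain ⟨g, rfl, hg⟩ := key
  rw [← sub_eq_zero, ← map_sub, toAssocGradedModule_eq_zero_iff] at hf
  have h1 : f.1.coeff 0 - g.1.coeff 0 ∈ (ratliffRush I M).N 1 := hf 0
  simpa using add_mem h1 hg

/-- If F_1 = M, then I^N M ⊆ F_(N+1) = I^(N+1)M for large N, so I^N M = 0 by Nakayama; but x^N acts
injectively. -/
theorem ratliffRush_one_ne_top [IsLocalRing A] [IsNoetherianRing A] [Module.Finite A M]
    [Nontrivial M] (h : IsSuperficialReduction I M c x y) (hc : 1 ≤ c)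
    (hI : I ≤ maximalIdeal A) : (ratliffRush I M).N 1 ≠ ⊤ := by
  intro htop
  obtain ⟨N, hN⟩ := h.exists_ratliffRush_eq hc
  have hbot : I ^ N • (⊤ : Submodule A M) = ⊥ := by
    refine Submodule.eq_bot_of_le_smul_of_le_jacobson_bot I _ (IsNoetherian.noetherian _) ?_
      (hI.trans (maximalIdeal_le_jacobson _))
    have h1 := (ratliffRush I M).pow_smul_le N 1
    rwa [htop, hN _ (by omega), pow_succ', Submodule.mul_smul] at h1
  obtain ⟨m, hm⟩ := exists_ne (0 : M)
  refine hm ((h.pair.pow_left N).left m ?_)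
  rw [← Submodule.mem_bot A, ← hbot]
  refine Submodule.smul_mem_smul (Ideal.pow_le_pow_right (Nat.le_mul_of_pos_left N hc) ?_) trivial
  rw [pow_mul]
  exact Ideal.pow_mem_pow h.left_mem N

/-- The initial forms of `x, y` are a regular sequence on the associated graded module. -/
theorem isRegular [IsLocalRing A] [IsNoetherianRing A] [Module.Finite A M]
    [Nontrivial M] (h : IsSuperficialReduction I M c x y) (hc : 1 ≤ c)
    (hI : I ≤ maximalIdeal A)
    (hgen : ∀ n, (ratliffRush I M).N (n + c + c) ≤
      mulSub x ((ratliffRush I M).N (n + c)) ⊔ mulSub y ((ratliffRush I M).N (n + c))) :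
    RingTheory.Sequence.IsRegular (AssocGradedModule (ratliffRush I M))
      [toAssocGradedRing I (reesMonomial c x h.left_mem),
        toAssocGradedRing I (reesMonomial c y h.right_mem)] := by
  refine ⟨.cons h.isSMulRegular_left (.cons (h.isSMulRegular_right hc hgen) (.nil _ _)), ?_⟩
  intro htop
  refine h.ratliffRush_one_ne_top hc hI (eq_top_iff.2 fun m _ => ?_)
  have hm : m ∈ (ratliffRush I M).N 0 := by rw [ratliffRush_zero]; trivial
  have hmem : initialForm (ratliffRush I M) 0 m hm ∈
      (⊤ : Submodule (AssocGradedRing I) (AssocGradedModule (ratliffRush I M))) := trivial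
  rw [htop] at hmem
  have := h.coeff_zero_mem hc hmem rfl
  rwa [reesSingle_coeff_self] at this

theorem two_le_depth [IsLocalRing A] [IsNoetherianRing A] [Module.Finite A M]
    [Nontrivial M] (h : IsSuperficialReduction I M c x y) (hc : 1 ≤ c)
    (hI : I ≤ maximalIdeal A)
    (hgen : ∀ n, (ratliffRush I M).N (n + c + c) ≤
      mulSub x ((ratliffRush I M).N (n + c)) ⊔ mulSub y ((ratliffRush I M).N (n + c))) :
    2 ≤ depth (AssocGradedRing I) (homogeneousMaximalIdeal I)
      (AssocGradedModule (ratliffRush I M)) := by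
  have hmem : ∀ (z : A) (hz : z ∈ I ^ c),
      toAssocGradedRing I (reesMonomial c z hz) ∈ homogeneousMaximalIdeal I := by
    intro z hz
    refine Ideal.mem_map_of_mem _ ?_
    change Polynomial.constantCoeff (Polynomial.monomial c z) ∈ maximalIdeal A
    rw [Polynomial.constantCoeff_apply, Polynomial.coeff_monomial, if_neg (by omega)]
    exact zero_mem _
  refine le_trans ?_ (le_iSup₂ (f := fun (rs : List (AssocGradedRing I)) _ => (rs.length : ℕ∞))
    _ ⟨?_, h.isRegular hc hI hgen⟩)
  · simp
  · intro r hr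
    simp only [List.mem_cons, List.not_mem_nil, or_false] at hr
    rcases hr with rfl | rfl
    · exact hmem _ _
    · exact hmem _ _

end IsSuperficialReduction
end AssociatedGraded

/-! ### Bounds on depth and dimension. -/

section Dimension

/-- The length of a regular sequence is at most the dimension. -/
theorem length_le_supportDim {R : Type u} [CommRing R] [IsNoetherianRing R] {E : Type v}
    [AddCommGroup E] [Module R E] [Module.Finite R E] (rs : List R)
    (h : RingTheory.Sequence.IsRegular E rs) :
    ((rs.length : ℕ∞) : WithBot ℕ∞) ≤ Module.supportDim R E := by
  induction rs generalizing E with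
  | nil =>
    have := h.nontrivial
    rw [List.length_nil, Nat.cast_zero]
    have hne := Module.supportDim_ne_bot_of_nontrivial R E
    obtain ⟨d, hd⟩ := WithBot.ne_bot_iff_exists.1 hne
    rw [← hd]
    exact WithBot.coe_le_coe.2 zero_le
  | cons r rs ih =>
    rw [RingTheory.Sequence.isRegular_cons_iff] at h
    have h1 := ih h.2
    have h2 := Module.supportDim_quotSMulTop_succ_le_of_notMem_minimalPrimes
      (R := R) (M := E) (x := r) (fun _ => h.1.notMem_of_mem_minimalPrimes)
    refine le_trans ?_ h2
    rw [List.length_cons]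
    push_cast
    exact add_le_add_left h1 1

theorem depth_le_supportDim {R : Type u} [CommRing R] [IsNoetherianRing R] {E : Type v}
    [AddCommGroup E] [Module R E] [Module.Finite R E] [Nontrivial E] (J : Ideal R) :
    (depth R J E : WithBot ℕ∞) ≤ Module.supportDim R E := by
  obtain ⟨d, hd⟩ := WithBot.ne_bot_iff_exists.1 (Module.supportDim_ne_bot_of_nontrivial R E)
  rw [← hd, WithBot.coe_le_coe]
  refine iSup₂_le fun rs h => ?_
  have := length_le_supportDim rs h.2
  rwa [← hd, WithBot.coe_le_coe] at this

/-- Incomparability makes contraction of primes strictly monotone; injectivity of f is not needed.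
-/
theorem ringKrullDim_le_of_isIntegral {R : Type u} {T : Type v} [CommRing R] [CommRing T]
    (f : R →+* T) (hf : f.IsIntegral) : ringKrullDim T ≤ ringKrullDim R := by
  let := f.toAlgebra
  have : Algebra.IsIntegral R T := ⟨hf⟩
  refine Order.krullDim_le_of_strictMono (fun P => PrimeSpectrum.comap f P) fun P Q hPQ => ?_
  exact Ideal.IsIntegral.comap_lt_comap (R := R) (I := P.asIdeal) (J := Q.asIdeal) hPQ

/-- The dimension of a module that is finite over a subring acting through a homomorphism. -/
theorem ringKrullDim_quotient_annihilator_le {S : Type u} {B : Type v} {E : Type w} [CommRing S]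
    [CommRing B] [Algebra S B] [AddCommGroup E] [Module B E] [Module S E] [IsScalarTower S B E]
    [Module.Finite S E] (q : Ideal S) (hq : ∀ s ∈ q, ∀ e : E, s • e = 0) :
    ringKrullDim (B ⧸ Module.annihilator B E) ≤ ringKrullDim (S ⧸ q) := by
  have hle : ∀ s ∈ q,
      ((Ideal.Quotient.mk (Module.annihilator B E)).comp (algebraMap S B)) s = 0 := by
    intro s hs
    rw [RingHom.comp_apply, Ideal.Quotient.eq_zero_iff_mem,
      Module.mem_annihilator]
    intro e
    rw [algebraMap_smul]
    exact hq s hs e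
  refine ringKrullDim_le_of_isIntegral (Ideal.Quotient.lift q _ hle) ?_
  refine RingHom.IsIntegral.tower_top (Ideal.Quotient.mk q) _ ?_
  rw [Ideal.Quotient.lift_comp_mk]
  intro t
  obtain ⟨b, rfl⟩ := Ideal.Quotient.mk_surjective t
  let τ : B →+* Module.End S E := Module.toModuleEnd S E
  -- Cayley–Hamilton on the finite S-module E: a monic polynomial in b acts as zero, so it vanishes
  -- modulo the annihilator.
  obtain ⟨p, hp, hp0⟩ := LinearMap.exists_monic_and_aeval_eq_zero S (τ b)
  refine ⟨p, hp, ?_⟩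
  rw [← Polynomial.hom_eval₂, Ideal.Quotient.eq_zero_iff_mem, Module.mem_annihilator]
  intro e
  have hτ : τ (p.eval₂ (algebraMap S B) b) = 0 := by
    rw [Polynomial.hom_eval₂]
    have : τ.comp (algebraMap S B) = algebraMap S (Module.End S E) := by
      ext s e
      exact algebraMap_smul B s e
    rw [this]
    exact hp0
  exact congrArg (fun g : Module.End S E => g e) hτ

theorem ringKrullDim_mvPolynomial_quotient {A : Type u} [CommRing A] [IsLocalRing A]
    [IsNoetherianRing A] (s : ℕ) :
    ringKrullDim (MvPolynomial (Fin 2) A ⧸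
      (maximalIdeal A ^ (s + 1)).map (MvPolynomial.C (σ := Fin 2))) ≤ 2 := by
  have := isArtinianRing_quotient_maximalIdeal_pow (A := A) s
  rw [← ringKrullDim_eq_of_ringEquiv
    (MvPolynomial.quotientEquivQuotientMvPolynomial (σ := Fin 2)
      (maximalIdeal A ^ (s + 1))).toRingEquiv, MvPolynomial.ringKrullDim_of_isNoetherianRing]
  have h0 : ringKrullDim (A ⧸ maximalIdeal A ^ (s + 1)) ≤ 0 :=
    (Ring.krullDimLE_iff (n := 0)).1 inferInstance
  calc _ ≤ (0 : WithBot ℕ∞) + (Nat.card (Fin 2) : WithBot ℕ∞) := add_le_add_left h0 _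
    _ = 2 := by simp

end Dimension

/-! ### The associated graded module over a polynomial ring in two variables. -/

section AssociatedGradedDimension

variable {A : Type u} [CommRing A] {I : Ideal A} {M : Type v} [AddCommGroup M] [Module A M]

instance [IsNoetherianRing A] : IsNoetherianRing (AssocGradedRing I) :=
  inferInstanceAs (IsNoetherianRing (reesAlgebra I ⧸ I.map (algebraMap A (reesAlgebra I))))

theorem initialForm_add {F : I.Filtration M} {n : ℕ} {m m' : M} (hm : m ∈ F.N n)
    (hm' : m' ∈ F.N n) : initialForm F n (m + m') (add_mem hm hm') =
      initialForm F n m hm + initialForm F n m' hm' := by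
  rw [initialForm, initialForm, initialForm, ← map_add]
  exact congrArg _ (Subtype.ext (PolynomialModule.single_add _ _ _))

theorem reesMonomial_smul_initialForm {F : I.Filtration M} {j n : ℕ} {d : A} (hd : d ∈ I ^ j)
    {m : M} (hm : m ∈ F.N n) : toAssocGradedRing I (reesMonomial j d hd) • initialForm F n m hm =
      initialForm F (n + j) (d • m) (filtration_smul_mem F hd hm) := by
  rw [toAssocGradedRing_smul, initialForm, initialForm, ← map_smul]
  refine congrArg _ (Subtype.ext ?_)
  change _ = PolynomialModule.single A (n + j) (d • m)
  rw [add_comm]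
  exact PolynomialModule.monomial_smul_single _ _ _ _

theorem assocGradedModule_induction {F : I.Filtration M} {p : AssocGradedModule F → Prop}
    (zero : p 0) (add : ∀ a b, p a → p b → p (a + b))
    (form : ∀ n m hm, p (initialForm F n m hm)) (q : AssocGradedModule F) : p q := by
  obtain ⟨⟨f, hf⟩, rfl⟩ := toAssocGradedModule_surjective F q
  have hf' : f ∈ AddSubmonoid.closure (⋃ i, PolynomialModule.single A i '' (F.N i : Set M)) := by
    rw [Ideal.Filtration.submodule_closure_single]
    exact hf
  have key : ∃ hf, p (toAssocGradedModule F ⟨f, hf⟩) := by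
    refine AddSubmonoid.closure_induction
      (motive := fun f _ => ∃ hf, p (toAssocGradedModule F ⟨f, hf⟩)) ?_ ?_ ?_ hf'
    · intro g hg
      obtain ⟨n, m, hm, rfl⟩ := Set.mem_iUnion.1 hg
      exact ⟨_, form n m hm⟩
    · exact ⟨zero_mem _, by
        have := map_zero (toAssocGradedModule F)
        exact this.symm ▸ zero⟩
    · rintro g g' _ _ ⟨hg, hpg⟩ ⟨hg', hpg'⟩
      refine ⟨add_mem hg hg', ?_⟩
      have := add _ _ hpg hpg'
      exact (map_add (toAssocGradedModule F) ⟨g, hg⟩ ⟨g', hg'⟩).symm ▸ this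
  exact key.2

namespace IsSuperficialReduction

variable {c : ℕ} {x y : A}

open Classical in
/-- The associated graded module of the Ratliff-Rush filtration has dimension at most two and is
finitely generated. -/
theorem supportDim_le_two [IsLocalRing A] [IsNoetherianRing A] [Module.Finite A M]
    (h : IsSuperficialReduction I M c x y) (hc : 1 ≤ c) (hI : IsIdealOfDefinition I M) :
    Module.Finite (AssocGradedRing I) (AssocGradedModule (ratliffRush I M)) ∧
    Module.supportDim (AssocGradedRing I) (AssocGradedModule (ratliffRush I M)) ≤ 2 := by
  obtain ⟨N₁, hN₁⟩ := h.exists_ratliffRush_eq hc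
  obtain ⟨N₂, hN₂⟩ := h.generate
  set F := ratliffRush I M
  have hconst : ∀ a : A, a ∈ I ^ 0 := fun a => by simp
  let X := toAssocGradedRing I (reesMonomial c x h.left_mem)
  let Y := toAssocGradedRing I (reesMonomial c y h.right_mem)
  let ρ : MvPolynomial (Fin 2) A →+* AssocGradedRing I :=
    MvPolynomial.eval₂Hom ((toAssocGradedRing I).comp (algebraMap A (reesAlgebra I))) ![X, Y]
  let _ : Algebra (MvPolynomial (Fin 2) A) (AssocGradedRing I) := ρ.toAlgebra
  let _ : Module (MvPolynomial (Fin 2) A) (AssocGradedModule F) :=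
    Module.compHom (AssocGradedModule F) ρ
  have : IsScalarTower (MvPolynomial (Fin 2) A) (AssocGradedRing I) (AssocGradedModule F) :=
    ⟨fun a b e => mul_smul (ρ a) b e⟩
  have hsmul : ∀ (p : MvPolynomial (Fin 2) A) (e : AssocGradedModule F), p • e = ρ p • e :=
    fun _ _ => rfl
  have hC : ∀ (a : A) n m (hm : m ∈ F.N n), (MvPolynomial.C a : MvPolynomial (Fin 2) A) •
      initialForm F n m hm = initialForm F n (a • m) (Submodule.smul_mem _ _ hm) := by
    intro a n m hm
    rw [hsmul, MvPolynomial.eval₂Hom_C]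
    exact reesMonomial_smul_initialForm (hconst a) hm
  have hX : ∀ n m (hm : m ∈ F.N n), (MvPolynomial.X 0 : MvPolynomial (Fin 2) A) •
      initialForm F n m hm = initialForm F (n + c) (x • m)
        (filtration_smul_mem F h.left_mem hm) := by
    intro n m hm
    rw [hsmul, MvPolynomial.eval₂Hom_X']
    exact reesMonomial_smul_initialForm _ hm
  have hY : ∀ n m (hm : m ∈ F.N n), (MvPolynomial.X 1 : MvPolynomial (Fin 2) A) •
      initialForm F n m hm = initialForm F (n + c) (y • m)
        (filtration_smul_mem F h.right_mem hm) := by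
    intro n m hm
    rw [hsmul, MvPolynomial.eval₂Hom_X']
    exact reesMonomial_smul_initialForm _ hm
  choose g hg using fun n => (IsNoetherian.noetherian (F.N n) : (F.N n).FG)
  -- From degree K on, F_n is adic and generated by x and y over F_(n-c), so generators of F_n for n
  -- < K suffice.
  let K := N₁ + N₂ + c
  let gens : Finset (AssocGradedModule F) := (Finset.range K).biUnion fun n =>
    (g n).image fun m => if hm : m ∈ F.N n then initialForm F n m hm else 0
  have hgen : ∀ n m (hm : m ∈ F.N n), initialForm F n m hm ∈
      Submodule.span (MvPolynomial (Fin 2) A) (gens : Set (AssocGradedModule F)) := by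
    intro n
    induction n using Nat.strong_induction_on with
    | _ n ih =>
      intro m hm
      by_cases hn : n < K
      · have hm' : m ∈ Submodule.span A (g n : Set M) := by rwa [hg]
        have key : ∃ hm, initialForm F n m hm ∈
            Submodule.span (MvPolynomial (Fin 2) A) (gens : Set (AssocGradedModule F)) := by
          refine Submodule.span_induction (p := fun m _ => ∃ hm, initialForm F n m hm ∈
            Submodule.span (MvPolynomial (Fin 2) A) (gens : Set (AssocGradedModule F)))
            ?_ ?_ ?_ ?_ hm'
          · intro m hmg
            have hmF : m ∈ F.N n := by
              rw [← hg n]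
              exact Submodule.subset_span hmg
            refine ⟨hmF, Submodule.subset_span ?_⟩
            rw [Finset.mem_coe, Finset.mem_biUnion]
            exact ⟨n, Finset.mem_range.2 hn, Finset.mem_image.2 ⟨m, hmg, dif_pos hmF⟩⟩
          · refine ⟨zero_mem _, ?_⟩
            have := hC 0 n 0 (zero_mem _)
            simp only [zero_smul, map_zero] at this
            rw [← this]
            exact zero_mem _
          · rintro a b _ _ ⟨ha, ha'⟩ ⟨hb, hb'⟩
            refine ⟨add_mem ha hb, ?_⟩
            rw [initialForm_add ha hb]
            exact add_mem ha' hb'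
          · rintro a b _ ⟨hb, hb'⟩
            refine ⟨Submodule.smul_mem _ _ hb, ?_⟩
            rw [← hC a n b hb]
            exact Submodule.smul_mem _ _ hb'
        exact key.2
      · obtain ⟨j, rfl⟩ : ∃ j, n = j + c := ⟨n - c, by omega⟩
        have hm' := hm
        rw [hN₁ _ (by omega)] at hm'
        obtain ⟨_, ⟨p, hp, rfl⟩, _, ⟨q, hq, rfl⟩, e⟩ := Submodule.mem_sup.1 (hN₂ j (by omega) hm')
        have hp' : p ∈ F.N j := le_ratliffRush j hp
        have hq' : q ∈ F.N j := le_ratliffRush j hq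
        have e' : x • p + y • q = m := e
        have : initialForm F (j + c) m hm = (MvPolynomial.X 0 : MvPolynomial (Fin 2) A) •
            initialForm F j p hp' + (MvPolynomial.X 1 : MvPolynomial (Fin 2) A) •
              initialForm F j q hq' := by
          rw [hX, hY, ← initialForm_add]
          congr 1
          exact e'.symm
        rw [this]
        exact add_mem (Submodule.smul_mem _ _ (ih j (by omega) p hp'))
          (Submodule.smul_mem _ _ (ih j (by omega) q hq'))
  have hfinS : Module.Finite (MvPolynomial (Fin 2) A) (AssocGradedModule F) := by
    refine ⟨⟨gens, eq_top_iff.2 fun e _ => ?_⟩⟩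
    exact assocGradedModule_induction (zero_mem _) (fun _ _ => add_mem) hgen e
  have hfin : Module.Finite (AssocGradedRing I) (AssocGradedModule F) :=
    Module.Finite.of_restrictScalars_finite (MvPolynomial (Fin 2) A) _ _
  refine ⟨hfin, ?_⟩
  rw [Module.supportDim_eq_ringKrullDim_quotient_annihilator]
  obtain ⟨-, k, hk⟩ := hI
  refine (ringKrullDim_quotient_annihilator_le (S := MvPolynomial (Fin 2) A) _ ?_).trans
    (ringKrullDim_mvPolynomial_quotient (A := A) (k * (N₁ + 1)))
  -- A fixed power of 𝔪 kills the graded module: below N₁ it carries all of M into I^(N₁+1)M, and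
  -- from N₁ on it suffices that 𝔪^k M ⊆ IM.
  have hpow : ∀ n, maximalIdeal A ^ (k * (N₁ + 1)) • F.N n ≤ F.N (n + 1) := by
    intro n
    by_cases hn : n < N₁
    · refine (smul_mono_right _ le_top).trans
        ((pow_mul_smul_le hk _).trans ((le_ratliffRush _).trans (F.antitone (by omega))))
    · rw [hN₁ n (by omega), ← Submodule.mul_smul, mul_comm, Submodule.mul_smul]
      refine (smul_mono_right _ ((Submodule.smul_mono_left
        (Ideal.pow_le_pow_right (m := k) (by nlinarith))).trans hk)).trans ?_
      rw [← Submodule.mul_smul, ← pow_succ]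
      exact le_ratliffRush _
  intro s hs e
  refine Submodule.span_induction (p := fun s _ => s • e = 0) ?_ (zero_smul _ _)
    (fun a b _ _ ha hb => by rw [add_smul, ha, hb, add_zero])
    (fun a b _ hb => by rw [smul_eq_mul, mul_smul, hb, smul_zero]) hs
  rintro _ ⟨a, ha, rfl⟩
  refine assocGradedModule_induction (p := fun e => (MvPolynomial.C a) • e = 0) (smul_zero _)
    (fun _ _ h1 h2 => by rw [smul_add, h1, h2, add_zero]) (fun n m hm => ?_) e
  rw [hC, initialForm, toAssocGradedModule_eq_zero_iff]
  intro i
  change (PolynomialModule.single A n (a • m)).coeff i ∈ _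
  rw [PolynomialModule.coeff_single, Finsupp.single_apply]
  split_ifs with hi
  · subst hi
    exact hpow n (Submodule.smul_mem_smul (Ideal.pow_le_pow_right (Nat.le_succ _) ha) hm)
  · exact zero_mem _

theorem isCohenMacaulay_assocGradedModule [IsLocalRing A] [IsNoetherianRing A] [Module.Finite A M]
    [Nontrivial M] (h : IsSuperficialReduction I M c x y) (hc : 1 ≤ c)
    (hI : IsIdealOfDefinition I M)
    (hgen : ∀ n, (ratliffRush I M).N (n + c + c) ≤
      mulSub x ((ratliffRush I M).N (n + c)) ⊔ mulSub y ((ratliffRush I M).N (n + c))) :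
    IsCohenMacaulay (AssocGradedRing I) (homogeneousMaximalIdeal I)
      (AssocGradedModule (ratliffRush I M)) := by
  intro hnt
  obtain ⟨hfin, hdim⟩ := h.supportDim_le_two hc hI
  have h1 : (2 : WithBot ℕ∞) ≤ depth (AssocGradedRing I) (homogeneousMaximalIdeal I)
      (AssocGradedModule (ratliffRush I M)) :=
    WithBot.coe_le_coe.2 (h.two_le_depth hc hI.1 hgen)
  exact le_antisymm (depth_le_supportDim _) (hdim.trans h1)

end IsSuperficialReduction

end AssociatedGradedDimension

/-! ### The equivalence. -/

section MinimalMultiplicity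

variable {A : Type u} [CommRing A] [IsLocalRing A] [IsNoetherianRing A] {I : Ideal A}
  {M : Type v} [AddCommGroup M] [Module A M] [Module.Finite A M]

theorem relLength_ratliffRush_ne_top (hI : IsIdealOfDefinition I M) (n : ℕ) :
    relLength ⊤ ((ratliffRush I M).N n) ≠ ⊤ :=
  ne_top_of_le_ne_top (relLength_adic_ne_top hI n) (relLength_mono le_rfl (le_ratliffRush n))

theorem exists_isHPolynomial_adic (hdim : Module.supportDim A M = 2)
    (hCM : IsCohenMacaulay A (maximalIdeal A) M) (hI : IsIdealOfDefinition I M) :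
    ∃ h, IsHPolynomial (I.stableFiltration (⊤ : Submodule A M)) h :=
  exists_isHPolynomial hdim (eventuallyPoly_hilbertFunction_adic hdim hCM hI)

theorem exists_isHPolynomial_ratliffRush (hdim : Module.supportDim A M = 2)
    (hCM : IsCohenMacaulay A (maximalIdeal A) M) (hI : IsIdealOfDefinition I M) {N : ℕ}
    (hN : ∀ n ≥ N, (ratliffRush I M).N n = I ^ n • (⊤ : Submodule A M)) :
    ∃ f, IsHPolynomial (ratliffRush I M) f := by
  refine exists_isHPolynomial hdim
    ((eventuallyPoly_hilbertFunction_adic hdim hCM hI).congr (N := N) fun n hn => ?_)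
  change (((relLength (I ^ n • (⊤ : Submodule A M)) (I ^ (n + 1) • ⊤)).toNat : ℕ) : ℤ) =
    (((relLength ((ratliffRush I M).N n) ((ratliffRush I M).N (n + 1))).toNat : ℕ) : ℤ)
  rw [hN n hn, hN (n + 1) (by omega)]

/-- The coefficient `e₂` of the adic filtration and of the Ratliff-Rush filtration agree. -/
theorem hilbertCoeff_two_eq (hdim : Module.supportDim A M = 2)
    (hCM : IsCohenMacaulay A (maximalIdeal A) M) (hI : IsIdealOfDefinition I M) {N : ℕ}
    (hN : ∀ n ≥ N, (ratliffRush I M).N n = I ^ n • (⊤ : Submodule A M)) {f : Polynomial ℤ}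
    (hf : IsHPolynomial (ratliffRush I M) f) :
    hilbertCoeff I M 2 = (Polynomial.hasseDeriv 2 f).eval 1 := by
  obtain ⟨h, hh⟩ := exists_isHPolynomial_adic hdim hCM hI
  rw [hilbertCoeff, ← hh.eq_hPolynomial]
  refine hh.hasseDeriv_two_eval_eq hdim ?_ (relLength_adic_ne_top hI) ratliffRush_zero
    (relLength_ratliffRush_ne_top hI) hf ⟨N, fun n hn => ?_⟩
  · change I ^ 0 • (⊤ : Submodule A M) = ⊤
    rw [pow_zero, Ideal.one_eq_top, Submodule.top_smul]
  · rw [colength, colength, hN n hn]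
    rfl

theorem IsSuperficialReduction.relLength_top_ne_top {c : ℕ} {x y : A}
    (h : IsSuperficialReduction I M c x y) (hI : IsIdealOfDefinition I M) :
    relLength ⊤ (mulSub x (⊤ : Submodule A M) ⊔ mulSub y ⊤) ≠ ⊤ := by
  obtain ⟨N, hN⟩ := h.generate
  exact ne_top_of_le_ne_top (relLength_adic_ne_top hI (N + c)) (relLength_mono le_rfl
    ((hN N le_rfl).trans (sup_le_sup (mulSub_mono le_top) (mulSub_mono le_top))))

theorem hilbertCoeff_two_eq_zero_iff (hdim : Module.supportDim A M = 2)
    (hCM : IsCohenMacaulay A (maximalIdeal A) M) (hI : IsIdealOfDefinition I M) :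
    hilbertCoeff I M 2 = 0 ↔ HasMinimalMultiplicity (ratliffRush I M) := by
  have hnt : Nontrivial M := by
    rw [← Module.supportDim_ne_bot_iff_nontrivial A, hdim]
    exact WithBot.coe_ne_bot (a := (2 : ℕ∞))
  obtain ⟨N, hN⟩ : ∃ N, ∀ n ≥ N, (ratliffRush I M).N n = I ^ n • (⊤ : Submodule A M) := by
    obtain ⟨c, -, x, y, hc, h⟩ := exists_isSuperficialReduction hdim hCM hI 0
    exact h.exists_ratliffRush_eq hc
  constructor
  · intro he
    obtain ⟨f, hf⟩ := exists_isHPolynomial_ratliffRush hdim hCM hI hN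
    rw [hilbertCoeff_two_eq hdim hCM hI hN hf] at he
    obtain ⟨r, hr⟩ := exists_taylor_expansion f
    -- The thresholds N and deg r depend only on F, so a second reduction can be chosen with c
    -- beyond both.
    obtain ⟨c, hcB, x, y, hc, h⟩ :=
      exists_isSuperficialReduction hdim hCM hI (N + r.natDegree + 2)
    obtain ⟨hgen, hdeg⟩ := h.of_hasseDeriv_two_eval_eq_zero hdim hc
      (relLength_ratliffRush_ne_top hI) (h.relLength_top_ne_top hI)
      (fun n hn => hN n (by omega)) hf hr (by omega) he
    exact ⟨h.isCohenMacaulay_assocGradedModule hc hI hgen, f, hf, hdeg⟩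
  · rintro ⟨-, f, hf, hdeg⟩
    rw [hilbertCoeff_two_eq hdim hCM hI hN hf,
      Polynomial.hasseDeriv_eq_zero_of_lt_natDegree _ _ (by omega), Polynomial.eval_zero]

end MinimalMultiplicity

end RatliffRush

/-- The first conjunct certifies that `hilbertCoeff` is computed from a genuine h-polynomial and not
from the default value 0. -/
theorem theorem7p1 {A : Type*} [CommRing A] [IsLocalRing A] [IsNoetherianRing A]
    {M : Type*} [AddCommGroup M] [Module A M] [Module.Finite A M]
    (hdim : Module.supportDim A M = 2)
    (hCM : RatliffRush.IsCohenMacaulay A (IsLocalRing.maximalIdeal A) M)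
    (I : Ideal A) (hI : RatliffRush.IsIdealOfDefinition I M) :
    (∃ h : Polynomial ℤ,
      RatliffRush.IsHPolynomial (I.stableFiltration (⊤ : Submodule A M)) h) ∧
    (RatliffRush.hilbertCoeff I M 2 = 0 ↔
      RatliffRush.HasMinimalMultiplicity (RatliffRush.ratliffRush I M)) := by
  exact ⟨RatliffRush.exists_isHPolynomial_adic hdim hCM hI,
    RatliffRush.hilbertCoeff_two_eq_zero_iff hdim hCM hI⟩
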